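/- Let $k\ge 2$. A $k$-uniform hypergraph $G=(V,E)$ has a finite vertex set $V$ and a set $E$ of edges, each a set of exactly $k$ vertices. A path of length $l$ is a sequence $u_1,e_1,u_2,\dots,u_l,e_l,u_{l+1}$ with distinct vertices $u_i$, distinct edges $e_i$ and $u_i,u_{i+1}\in e_i$; a cycle is a sequence $u_1,e_1,\dots,u_l,e_l,u_1$ with $l\ge 2$, distinct vertices $u_1,\dots,u_l$, distinct edges and $u_i,u_{i+1}\in e_i$ (with $u_{l+1}=u_1$). A supertree is a hypergraph with at least one vertex that is connected (any two vertices are joined by a path) and acyclic (it has no cycle). The distance of two vertices is the least length of a path between them, and the degree $d_v$ of a vertex $v$ is the number of edges containing $v$. The signless Laplacian tensor of $G$ is $\mathcal Q(G)=\mathcal D(G)+\mathcal A(G)$, a tensor of order $k$ indexed by $V$, where $\mathcal D(G)$ is diagonal with diagonal entries the degrees $d_v$, and the entry of $\mathcal A(G)$ at $(i_1,\dots,i_k)$ is $\frac1{(k-1)!}$ if $\{i_1,\dots,i_k\}\in E$ and $0$ otherwise. A complex number $\lambda$ is an eigenvalue of a tensor $\mathcal T=(t_{i_1\dots i_k})$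 if there is a nonzero $x\in\mathbb C^{V}$ with $\sum_{i_2,\dots,i_k\in V}t_{i i_2\dots i_k}x_{i_2}\cdots x_{i_k}=\lambda x_i^{k-1}$ for all $i\in V$. The signless Laplacian spectral radius $q(G)$ is the largest modulus of an eigenvalue of $\mathcal Q(G)$. A $k$-uniform supertree $G$ is a BFS-supertree if there are a root $v_0\in V$ and a (strict) well-ordering $\prec$ of $V$ such that, with $h(v)$ the distance from $v_0$ to $v$, the following hold for all vertices: (a) $u\prec v$ implies $h(u)\le h(v)$; (b) $u\prec v$ implies $d_u\ge d_v$; (c) if $\{u,u_1\}\subset e_1\in E$, $\{v,v_1\}\subset e_2\in E$, $u\prec v$, $h(u)=h(u_1)+1$ and $h(v)=h(v_1)+1$, then $u_1\prec v_1$ or $u_1=v_1$; (d) if $e=\{u_1,\dots,u_k\}\in E$ with $u_1\prec u_2\prec\dots\prec u_k$, then there is no $v\in V\setminus e$ with $u_i\prec v\prec u_{i+1}$ for some $2\le i\le k-1$. **Theorem.** Let $\pi=(d_0,d_1,\dots,d_{n-1})$ be the degree sequence of some $k$-uniform supertree, and let $\mathbb S_\pi$ be the set of $k$-uniform supertrees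 on $n$ vertices whose vertex degrees, listed in some order, are $d_0,\dots,d_{n-1}$. If $G\in\mathbb S_\pi$ satisfies $q(G')\le q(G)$ for all $G'\in\mathbb S_\pi$, then $G$ is a BFS-supertree. -/

import Mathlib

namespace Hypergraph

/-! ### Paths, cycles, distance, degrees, supertrees -/

/-- `u 0, e 0, u 1, e 1, …, e (l-1), u l` is a path of length `l`: the vertices are distinct, the
edges are distinct, and consecutive vertices lie in the edge between them. -/
structure IsPath {V : Type*} (H : Hypergraph V) (l : ℕ) (u : Fin (l + 1) → V)
    (e : Fin l → Set V) : Prop where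
  vertex_mem : ∀ i, u i ∈ H.vertexSet
  edge_mem : ∀ i, e i ∈ H.edgeSet
  vertex_injective : Function.Injective u
  edge_injective : Function.Injective e
  left_mem : ∀ i : Fin l, u i.castSucc ∈ e i
  right_mem : ∀ i : Fin l, u i.succ ∈ e i

/-- `u 0, e 0, u 1, …, u (l-1), e (l-1), u l = u 0` is a (Berge) cycle of length `l ≥ 2`: the
vertices `u 0, …, u (l-1)` are distinct, the edges are distinct, and consecutive vertices
(cyclically) lie in the edge between them. -/
structure IsCycle {V : Type*} (H : Hypergraph V) (l : ℕ) (u : Fin (l + 1) → V)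
    (e : Fin l → Set V) : Prop where
  two_le : 2 ≤ l
  closed : u (Fin.last l) = u 0
  edge_mem : ∀ i, e i ∈ H.edgeSet
  vertex_injective : Function.Injective (fun i : Fin l => u i.castSucc)
  edge_injective : Function.Injective e
  left_mem : ∀ i : Fin l, u i.castSucc ∈ e i
  right_mem : ∀ i : Fin l, u i.succ ∈ e i

/-- There is a path of length `l` from `x` to `y`. -/
def HasPath {V : Type*} (H : Hypergraph V) (x y : V) (l : ℕ) : Prop :=
  ∃ (u : Fin (l + 1) → V) (e : Fin l → Set V),
    H.IsPath l u e ∧ u 0 = x ∧ u (Fin.last l) = y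

/-- There is at least one vertex, and any two vertices are joined by a path. -/
def IsConnected {V : Type*} (H : Hypergraph V) : Prop :=
  H.vertexSet.Nonempty ∧ ∀ x ∈ H.vertexSet, ∀ y ∈ H.vertexSet, ∃ l, H.HasPath x y l

/-- There is no cycle. In particular two distinct edges share at most one vertex. -/
def IsAcyclic {V : Type*} (H : Hypergraph V) : Prop :=
  ∀ (l : ℕ) (u : Fin (l + 1) → V) (e : Fin l → Set V), ¬ H.IsCycle l u e

/-- The length of a shortest path between two vertices. -/
noncomputable def pathDist {V : Type*} (H : Hypergraph V) (x y : V) : ℕ :=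
  sInf {l | H.HasPath x y l}

/-- The degree of a vertex: the number of edges containing it. -/
noncomputable def vertexDegree {V : Type*} (H : Hypergraph V) (v : V) : ℕ :=
  {e | e ∈ H.edgeSet ∧ v ∈ e}.ncard

/-- Every edge has exactly `k` vertices. -/
def IsUniform {V : Type*} (H : Hypergraph V) (k : ℕ) : Prop :=
  ∀ e ∈ H.edgeSet, e.encard = k

/-- `H` is a `k`-uniform supertree whose vertex set is the whole type `V`. -/
structure IsUniformSupertree {V : Type*} (H : Hypergraph V) (k : ℕ) : Prop where
  vertexSet_eq : H.vertexSet = Set.univ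
  uniform : H.IsUniform k
  connected : H.IsConnected
  acyclic : H.IsAcyclic

/-- The `k`-uniform supertrees with vertex set `V` and degree sequence `π`, i.e. `π` lists the
degrees of the vertices in some order. -/
def supertreesWithDegrees (V : Type*) (k : ℕ) {n : ℕ} (π : Fin n → ℕ) : Set (Hypergraph V) :=
  {H | H.IsUniformSupertree k ∧ ∃ σ : Fin n ≃ V, ∀ i, H.vertexDegree (σ i) = π i}

/-! ### Tensors, their eigenvalues, the signless Laplacian spectral radius -/

/-- Complex tensors of order `k` with all indices in `V`. The entry `a_{i i₂ … i_k}` of `T` is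
`T i j`, where `j = (i₂, …, i_k)` lists all the indices except the first one. -/
abbrev Tensor (V : Type*) (k : ℕ) : Type _ := V → (Fin (k - 1) → V) → ℂ

/-- The vector `T x^{k-1}`, whose `i`-th component is
`∑_{i₂, …, i_k} a_{i i₂ … i_k} x_{i₂} ⋯ x_{i_k}`. -/
noncomputable def Tensor.apply {V : Type*} [Fintype V] {k : ℕ} (T : Tensor V k) (x : V → ℂ) :
    V → ℂ :=
  open Classical in fun i => ∑ j : Fin (k - 1) → V, T i j * ∏ s, x (j s)

/-- `μ` is an eigenvalue of `T`: `T x^{k-1} = μ x^{[k-1]}` for some nonzero complex vector `x`. -/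
def Tensor.IsEigenvalue {V : Type*} [Fintype V] {k : ℕ} (T : Tensor V k) (μ : ℂ) : Prop :=
  ∃ x : V → ℂ, x ≠ 0 ∧ ∀ i, T.apply x i = μ * x i ^ (k - 1)

/-- The spectral radius: the largest modulus of an eigenvalue. -/
noncomputable def Tensor.spectralRadius {V : Type*} [Fintype V] {k : ℕ} (T : Tensor V k) : ℝ :=
  sSup {r : ℝ | ∃ μ : ℂ, T.IsEigenvalue μ ∧ r = ‖μ‖}

/-- The adjacency tensor of a `k`-uniform hypergraph: the entry `a_{i i₂ … i_k}` is `1 / (k-1)!`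
if `{i, i₂, …, i_k}` is an edge, and `0` otherwise. -/
noncomputable def adjacencyTensor {V : Type*} (H : Hypergraph V) (k : ℕ) : Tensor V k :=
  open Classical in fun i j =>
    if insert i (Set.range j) ∈ H.edgeSet then 1 / ((k - 1).factorial : ℂ) else 0

/-- The diagonal tensor with diagonal entries `d_{i i … i}` the degrees of the vertices. -/
noncomputable def degreeTensor {V : Type*} (H : Hypergraph V) (k : ℕ) : Tensor V k :=
  open Classical in fun i j => if ∀ s, j s = i then (H.vertexDegree i : ℂ) else 0

/-- The signless Laplacian tensor: the sum of the degree tensor and the adjacency tensor. -/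
noncomputable def signlessLaplacianTensor {V : Type*} (H : Hypergraph V) (k : ℕ) : Tensor V k :=
  fun i j => H.degreeTensor k i j + H.adjacencyTensor k i j

/-- The signless Laplacian spectral radius `q(H)` of a `k`-uniform hypergraph. -/
noncomputable def signlessSpectralRadius {V : Type*} [Fintype V] (H : Hypergraph V) (k : ℕ) : ℝ :=
  (H.signlessLaplacianTensor k).spectralRadius

/-! ### Breadth-first-search orderings -/

/-- The well-ordering `r` (written `≺`) of the vertices is a BFS-ordering of the `k`-uniform
hypergraph `H` with root `v₀`; the height of a vertex is its distance from the root. -/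
structure IsBFSOrdering {V : Type*} (H : Hypergraph V) (k : ℕ) (v₀ : V) (r : V → V → Prop) :
    Prop where
  wellOrder : IsWellOrder V r
  /-- `u ≺ v` implies `h(u) ≤ h(v)`. -/
  height_le : ∀ u v, r u v → H.pathDist v₀ u ≤ H.pathDist v₀ v
  /-- `u ≺ v` implies `d_u ≥ d_v`. -/
  degree_ge : ∀ u v, r u v → H.vertexDegree v ≤ H.vertexDegree u
  /-- If `u ≺ v`, then the parent `u₁` of `u` precedes or equals the parent `v₁` of `v`. -/
  parent_le : ∀ u v u₁ v₁ : V, ∀ e₁ ∈ H.edgeSet, ∀ e₂ ∈ H.edgeSet,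
    u ∈ e₁ → u₁ ∈ e₁ → v ∈ e₂ → v₁ ∈ e₂ → r u v →
    H.pathDist v₀ u = H.pathDist v₀ u₁ + 1 → H.pathDist v₀ v = H.pathDist v₀ v₁ + 1 →
    r u₁ v₁ ∨ u₁ = v₁
  /-- If `w 0 ≺ w 1 ≺ ⋯ ≺ w (k-1)` are the vertices of an edge `e`, then no vertex outside `e`
  lies between two consecutive ones among `w 1, …, w (k-1)`. -/
  edge_consecutive : ∀ e ∈ H.edgeSet, ∀ w : Fin k → V, Set.range w = e →
    (∀ i j, i < j → r (w i) (w j)) →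
    ∀ (i : ℕ) (hi : i + 1 < k), 1 ≤ i → ∀ v ∉ e,
      ¬ (r (w ⟨i, Nat.lt_of_succ_lt hi⟩) v ∧ r v (w ⟨i + 1, hi⟩))

/-- `H` is a `k`-uniform supertree which admits a BFS-ordering for some choice of the root. -/
def IsBFSSupertree {V : Type*} (H : Hypergraph V) (k : ℕ) : Prop :=
  H.IsUniformSupertree k ∧ ∃ (v₀ : V) (r : V → V → Prop), H.IsBFSOrdering k v₀ r

end Hypergraph

/-! For a connected $k$-uniform family, $q(G)$ is the maximum of $\mathcal Q
x^k=\sum_e\bigl(\sum_{v\in e}x_v^k+k\prod_{v\in e}x_v\bigr)$ over nonnegative $x$ with $\sum_v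
x_v^k=1$, attained at a positive vector (`signlessSpectralRadius_spec`). Fix such an $x$ for the
extremal $G$. If some $G'$ in the class has a form at $x$ at least as large, then $q(G')=q(G)$, $x$
is a maximizer for $G'$ too, and both hypergraphs satisfy the same eigenvalue equations at $x$; this
is `IsExtremal`. So no rearrangement within the class can keep the form from dropping and still
alter the equation at some vertex.

Two rearrangements are used. Moving edges from $u$ to $v$ so that their degrees are exchanged shows
that a larger degree forces a larger entry (`IsExtremal.lt_of_degree_lt`). Exchanging $p\in e$ with
$q\in f$ changes the form by $k(x_q-x_p)(A-B)$, where $A,B$ are the products over $e\setminus p$ and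
$f\setminus q$. When such exchanges preserve connectivity, $x_p\le x_q$ iff $\prod_e x\le\prod_f x$
(`IsExtremal.le_iff_prod_le`). Hence the comparison of one admissible pair passes to every other
admissible pair in the same two edges.

With the root at a maximum of $x$, this transfer carries comparisons from parents to children: $x$
weakly decreases with height (`IsExtremal.le_of_height_lt`), and inside a level, sorting by parent,
then edge product, then $x$ agrees with sorting by $x$. That lexicographic order is the
BFS-ordering, and degrees decrease along it because $x$ does.

A rearranged family is recognised as a supertree by counting: connected, $k$-uniform, $m$ edges and
$m(k-1)+1$ vertices suffice (`isUniformSupertree_of_card`). -/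

namespace EdgeFamily

open scoped Classical

/-! ### Edge families: connectivity, rooting, counting. -/

section

variable {V ι : Type*}

/-- Two vertices are adjacent if they lie in a common edge with index in `S`. -/
def shareGraph (E : ι → Finset V) (S : Set ι) : SimpleGraph V where
  Adj u w := u ≠ w ∧ ∃ i ∈ S, u ∈ E i ∧ w ∈ E i
  symm := ⟨fun _ _ ⟨h, i, hi, hu, hw⟩ => ⟨h.symm, i, hi, hw, hu⟩⟩
  loopless := ⟨fun _ h => h.1 rfl⟩

theorem reachable_of_mem {E : ι → Finset V} {S : Set ι} {i : ι} (hi : i ∈ S) {u w : V}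
    (hu : u ∈ E i) (hw : w ∈ E i) : (shareGraph E S).Reachable u w := by
  by_cases h : u = w
  · rw [h]
  · exact SimpleGraph.Adj.reachable (G := shareGraph E S) ⟨h, i, hi, hu, hw⟩

theorem Reachable.transfer {E : ι → Finset V} {S : Set ι} {G : SimpleGraph V}
    (hG : ∀ i ∈ S, ∀ u ∈ E i, ∀ w ∈ E i, G.Reachable u w) {u w : V}
    (h : (shareGraph E S).Reachable u w) : G.Reachable u w := by
  obtain ⟨p⟩ := h
  induction p with
  | nil => exact SimpleGraph.Reachable.refl _
  | cons hadj _ ih =>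
    obtain ⟨_, i, hi, hu, hw⟩ := hadj
    exact (hG i hi _ hu _ hw).trans ih

theorem Reachable.mono {E : ι → Finset V} {S T : Set ι} (hST : S ⊆ T) {u w : V}
    (h : (shareGraph E S).Reachable u w) : (shareGraph E T).Reachable u w :=
  Reachable.transfer (fun _ hi _ hu _ hw => reachable_of_mem (hST hi) hu hw) h

/-- The family is connected, and deleting an edge separates all its vertices. -/
structure IsArboreal (E : ι → Finset V) : Prop where
  connected : (shareGraph E Set.univ).Connected
  bridge : ∀ i, ∀ u ∈ E i, ∀ w ∈ E i, u ≠ w → ¬ (shareGraph E {i}ᶜ).Reachable u w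

/-- A family rooted at `v₀`: all vertices of an edge except its top are one level below the top,
and each vertex other than the root is a non-top vertex of exactly one edge. -/
structure Rooted (E : ι → Finset V) (v₀ : V) (h : V → ℕ) (top : ι → V) : Prop where
  height_root : h v₀ = 0
  top_mem : ∀ i, top i ∈ E i
  height_eq : ∀ i, ∀ v ∈ E i, v ≠ top i → h v = h (top i) + 1
  exists_edge : ∀ v, v ≠ v₀ → ∃ i, v ∈ E i ∧ v ≠ top i
  unique : ∀ v i j, v ∈ E i → v ≠ top i → v ∈ E j → v ≠ top j → i = j

section Dist

variable {E : ι → Finset V} (hE : (shareGraph E Set.univ).Connected) (v₀ : V)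
include hE

theorem dist_le_succ {i : ι} {u w : V} (hu : u ∈ E i) (hw : w ∈ E i) :
    (shareGraph E Set.univ).dist v₀ w ≤ (shareGraph E Set.univ).dist v₀ u + 1 := by
  by_cases h : u = w
  · rw [h]; omega
  · have hadj : (shareGraph E Set.univ).Adj u w := ⟨h, i, trivial, hu, hw⟩
    have := hE.dist_triangle (u := v₀) (v := u) (w := w)
    rwa [SimpleGraph.dist_eq_one_iff_adj.2 hadj] at this

theorem dist_pred {v : V} (hv : v ≠ v₀) : ∃ z i, v ∈ E i ∧ z ∈ E i ∧
    (shareGraph E Set.univ).dist v₀ z + 1 = (shareGraph E Set.univ).dist v₀ v := by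
  obtain ⟨p, hp⟩ := hE.exists_walk_length_eq_dist v v₀
  revert hp
  cases p with
  | nil => exact absurd rfl hv
  | @cons _ z _ hadj p =>
    intro hp
    have hadj' := hadj
    obtain ⟨_, i, -, h1, h2⟩ := hadj'
    refine ⟨z, i, h1, h2, ?_⟩
    have h3 := SimpleGraph.dist_le p
    have h4 := dist_le_succ hE v₀ h2 h1
    rw [SimpleGraph.dist_comm, SimpleGraph.dist_comm (u := v₀) (v := v), ← hp,
      SimpleGraph.Walk.length_cons]
    rw [SimpleGraph.dist_comm, SimpleGraph.dist_comm (u := v₀) (v := z), ← hp,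
      SimpleGraph.Walk.length_cons] at h4
    omega

omit hE in
theorem exists_top (hne : ∀ i, (E i).Nonempty) : ∃ top : ι → V, ∀ i, top i ∈ E i ∧
    ∀ w ∈ E i, (shareGraph E Set.univ).dist v₀ (top i) ≤ (shareGraph E Set.univ).dist v₀ w := by
  choose top h1 h2 using fun i => Finset.exists_min_image (E i)
    ((shareGraph E Set.univ).dist v₀) (hne i)
  exact ⟨top, fun i => ⟨h1 i, h2 i⟩⟩

variable {v₀} {top : ι → V}
  (htop : ∀ i, top i ∈ E i ∧
    ∀ w ∈ E i, (shareGraph E Set.univ).dist v₀ (top i) ≤ (shareGraph E Set.univ).dist v₀ w)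
include htop

theorem exists_parent {v : V} (hv : v ≠ v₀) : ∃ i, v ∈ E i ∧ v ≠ top i ∧
    (shareGraph E Set.univ).dist v₀ (top i) + 1 = (shareGraph E Set.univ).dist v₀ v := by
  obtain ⟨z, i, h1, h2, h3⟩ := dist_pred hE v₀ hv
  have h4 := (htop i).2 z h2
  have h5 := dist_le_succ hE v₀ (htop i).1 h1
  refine ⟨i, h1, ?_, by omega⟩
  rintro rfl
  omega

theorem rooted_of_unique
    (hu : ∀ v i j, v ∈ E i → v ≠ top i → v ∈ E j → v ≠ top j → i = j) :
    Rooted E v₀ ((shareGraph E Set.univ).dist v₀) top where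
  height_root := SimpleGraph.dist_self
  top_mem i := (htop i).1
  height_eq := by
    intro i v hv hvt
    have hv0 : v ≠ v₀ := by
      rintro rfl
      have := (htop i).2 _ hv
      rw [SimpleGraph.dist_self, Nat.le_zero, hE.dist_eq_zero_iff] at this
      exact hvt this
    obtain ⟨j, h1, h2, h3⟩ := exists_parent hE htop hv0
    rw [hu v i j hv hvt h1 h2, h3]
  exists_edge v hv := by
    obtain ⟨j, h1, h2, -⟩ := exists_parent hE htop hv
    exact ⟨j, h1, h2⟩
  unique := hu

/-- Climbing through parent edges meets only edges whose top is strictly lower than `v`. This bound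
is what shows that a given edge is avoided. -/
theorem descend (v : V) : (shareGraph E {i | (shareGraph E Set.univ).dist v₀ (top i) <
    (shareGraph E Set.univ).dist v₀ v}).Reachable v v₀ := by
  induction hn : (shareGraph E Set.univ).dist v₀ v using Nat.strong_induction_on generalizing v with
  | _ n ih =>
    by_cases hv : v = v₀
    · rw [hv]
    · obtain ⟨i, h1, h2, h3⟩ := exists_parent hE htop hv
      have h4 := ih _ (by omega) (top i) rfl
      refine (reachable_of_mem (i := i) ?_ h1 (htop i).1).trans (Reachable.mono ?_ h4)
      · simp only [Set.mem_ofPred_eq]; omega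
      · intro j hj
        simp only [Set.mem_ofPred_eq] at hj ⊢
        omega

end Dist

theorem IsArboreal.rooted {E : ι → Finset V} (hE : IsArboreal E)
    (hne : ∀ i, (E i).Nonempty) (v₀ : V) :
    ∃ top, Rooted E v₀ ((shareGraph E Set.univ).dist v₀) top := by
  obtain ⟨top, htop⟩ := exists_top v₀ hne
  refine ⟨top, rooted_of_unique hE.connected htop ?_⟩
  -- If `i` is a parent edge of `v` and `j ≠ i` also has `v` as a non-top vertex, then `v` through
  -- `i`, and `top j` by itself, both reach the root without using `j`, against the bridge property.
  have key : ∀ v j, v ∈ E j → v ≠ top j → ∀ i, v ∈ E i → v ≠ top i →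
      (shareGraph E Set.univ).dist v₀ (top i) + 1 = (shareGraph E Set.univ).dist v₀ v → i = j := by
    intro v j hj hjt i hi hit hd
    by_contra hij
    refine hE.bridge j v hj (top j) (htop j).1 hjt ?_
    have h1 : (shareGraph E {j}ᶜ).Reachable v (top i) := reachable_of_mem hij hi (htop i).1
    have hj1 := dist_le_succ hE.connected v₀ (htop j).1 hj
    have h2 : (shareGraph E {j}ᶜ).Reachable (top i) v₀ := by
      refine Reachable.mono ?_ (descend hE.connected htop (top i))
      rintro l hl rfl
      simp only [Set.mem_ofPred_eq] at hl
      omega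
    have h3 : (shareGraph E {j}ᶜ).Reachable (top j) v₀ := by
      refine Reachable.mono ?_ (descend hE.connected htop (top j))
      rintro l hl rfl
      simp only [Set.mem_ofPred_eq, lt_self_iff_false] at hl
    exact (h1.trans h2).trans h3.symm
  intro v i j hi hit hj hjt
  have hv : v ≠ v₀ := by
    rintro rfl
    have := (htop i).2 _ hi
    rw [SimpleGraph.dist_self, Nat.le_zero, hE.connected.dist_eq_zero_iff] at this
    exact hit this
  obtain ⟨l, h1, h2, h3⟩ := exists_parent hE.connected htop hv
  rw [← key v i hi hit l h1 h2 h3, ← key v j hj hjt l h1 h2 h3]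

section Count

variable [Fintype V] [Fintype ι] {E : ι → Finset V} {k : ℕ}

omit [Fintype V] in
theorem card_nontop (hk : ∀ i, (E i).card = k) {top : ι → V} (htop : ∀ i, top i ∈ E i) :
    (Finset.univ.sigma fun i => (E i).erase (top i)).card = Fintype.card ι * (k - 1) := by
  rw [Finset.card_sigma, Finset.sum_congr rfl fun i _ => by
    rw [Finset.card_erase_of_mem (htop i), hk i]]
  simp

/-- Each non-root vertex is a non-top vertex of exactly one edge, and each edge has `k - 1` non-top
vertices. -/
theorem Rooted.card_eq (hk : ∀ i, (E i).card = k) {v₀ : V} {h : V → ℕ} {top : ι → V}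
    (hR : Rooted E v₀ h top) : Fintype.card V = Fintype.card ι * (k - 1) + 1 := by
  rw [← card_nontop hk hR.top_mem, ← Finset.card_univ,
    ← Finset.card_erase_add_one (Finset.mem_univ v₀)]
  congr 1
  symm
  refine Finset.card_bij (fun p _ => p.2) ?_ ?_ ?_
  · rintro ⟨i, v⟩ hv
    simp only [Finset.mem_sigma, Finset.mem_univ, true_and, Finset.mem_erase] at hv
    simp only [Finset.mem_erase, Finset.mem_univ, and_true]
    rintro rfl
    have := hR.height_eq i _ hv.2 hv.1
    rw [hR.height_root] at this
    omega
  · rintro ⟨i, v⟩ hv ⟨j, w⟩ hw hvw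
    simp only [Finset.mem_sigma, Finset.mem_univ, true_and, Finset.mem_erase] at hv hw hvw
    subst hvw
    rw [hR.unique v i j hv.2 hv.1 hw.2 hw.1]
  · intro v hv
    obtain ⟨i, h1, h2⟩ := hR.exists_edge v (Finset.ne_of_mem_erase hv)
    exact ⟨⟨i, v⟩, by simp [h1, h2], rfl⟩

/-- By connectivity the non-top incidences cover all non-root vertices. Since the two cardinalities
agree, the covering map is injective, which is uniqueness of the parent edge. -/
theorem rooted_of_card (hE : (shareGraph E Set.univ).Connected) (hk : ∀ i, (E i).card = k)
    (hk0 : k ≠ 0) (hcard : Fintype.card V = Fintype.card ι * (k - 1) + 1) (v₀ : V) :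
    ∃ top, Rooted E v₀ ((shareGraph E Set.univ).dist v₀) top := by
  obtain ⟨top, htop⟩ := exists_top v₀ fun i => Finset.card_ne_zero.1 (by rw [hk i]; exact hk0)
  refine ⟨top, rooted_of_unique hE htop ?_⟩
  have hinj := Finset.injOn_of_surjOn_of_card_le (s := Finset.univ.sigma fun i => (E i).erase (top i))
    (t := Finset.univ.erase v₀) (fun p => p.2) ?_ ?_ ?_
  · intro v i j hi hit hj hjt
    have := @hinj ⟨i, v⟩ (by simp [hi, hit]) ⟨j, v⟩ (by simp [hj, hjt]) rfl
    simpa using this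
  · rintro ⟨i, v⟩ hv
    simp only [Finset.coe_sigma, Set.mem_sigma_iff, Finset.coe_univ, Set.mem_univ, true_and,
      Finset.mem_coe, Finset.mem_erase] at hv
    simp only [Finset.coe_erase, Finset.coe_univ, Set.mem_sdiff, Set.mem_univ, true_and,
      Set.mem_singleton_iff]
    rintro rfl
    have := (htop i).2 _ hv.2
    rw [SimpleGraph.dist_self, Nat.le_zero, hE.dist_eq_zero_iff] at this
    exact hv.1 this
  · intro v hv
    obtain ⟨i, h1, h2, -⟩ := exists_parent hE htop (Finset.ne_of_mem_erase hv)
    exact ⟨⟨i, v⟩, by simp [h1, h2], rfl⟩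
  · rw [card_nontop hk fun i => (htop i).1, Finset.card_erase_of_mem (Finset.mem_univ _),
      Finset.card_univ, hcard]
    simp

end Count

theorem Rooted.injective {E : ι → Finset V} {v₀ : V} {h : V → ℕ} {top : ι → V}
    (hR : Rooted E v₀ h top) (h2 : ∀ i, 2 ≤ (E i).card) : Function.Injective E := by
  intro i j hij
  have ht : top i = top j := by
    by_contra hne
    have h1 := hR.height_eq j (top i) (hij ▸ hR.top_mem i) hne
    have h3 := hR.height_eq i (top j) (hij ▸ hR.top_mem j) (Ne.symm hne)
    omega
  obtain ⟨v, hv, hvt⟩ := Finset.exists_mem_ne (h2 i) (top i)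
  exact hR.unique v i j hv hvt (hij ▸ hv) (ht ▸ hvt)

end

/-! ### Translation between edge families and hypergraphs. -/

section

variable {V ι : Type*}

/-- On a geodesic the `j`-th vertex is at distance `j` from `x`, while vertices of one edge are at
distance at most 1; so neither vertices nor edges repeat. -/
theorem exists_shortest {E : ι → Finset V} {S : Set ι} {x y : V}
    (hxy : (shareGraph E S).Reachable x y) :
    ∃ (u : Fin ((shareGraph E S).dist x y + 1) → V) (e : Fin ((shareGraph E S).dist x y) → ι),
      u 0 = x ∧ u (Fin.last _) = y ∧ Function.Injective u ∧ Function.Injective e ∧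
      ∀ j, e j ∈ S ∧ u j.castSucc ∈ E (e j) ∧ u j.succ ∈ E (e j) := by
  obtain ⟨p, hp⟩ := hxy.exists_walk_length_eq_dist
  have hdist : ∀ j, j ≤ p.length → (shareGraph E S).dist x (p.getVert j) = j := by
    intro j hj
    have h1 := SimpleGraph.dist_le (p.take j)
    have h2 := SimpleGraph.dist_le (p.drop j)
    have h3 := (p.take j).reachable.dist_triangle_left (w := y)
    rw [SimpleGraph.Walk.take_length] at h1
    rw [SimpleGraph.Walk.drop_length] at h2
    omega
  have hadj : ∀ j : Fin ((shareGraph E S).dist x y), ∃ i ∈ S,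
      p.getVert j ∈ E i ∧ p.getVert (j + 1) ∈ E i := fun j =>
    (p.adj_getVert_succ (i := j) (by omega)).2
  choose e he using hadj
  have hone : ∀ (i : ι), i ∈ S → ∀ a ∈ E i, ∀ b ∈ E i, (shareGraph E S).dist a b ≤ 1 := by
    intro i hi a ha b hb
    by_cases hab : a = b
    · rw [hab, SimpleGraph.dist_self]; omega
    · have hadj : (shareGraph E S).Adj a b := ⟨hab, i, hi, ha, hb⟩
      exact (SimpleGraph.dist_eq_one_iff_adj.2 hadj).le
  have key : ∀ a b : Fin ((shareGraph E S).dist x y), e a = e b → (b : ℕ) ≤ a := by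
    intro a b hab
    have h1 := hone _ (he a).1 _ (he a).2.1 _ (hab ▸ (he b).2.2)
    have h2 := hdist a (by omega)
    have h3 := hdist (b + 1) (by omega)
    have h4 := (p.take a).reachable.dist_triangle_left (w := p.getVert (b + 1))
    omega
  refine ⟨fun j => p.getVert j, e, by simp, by simp [← hp], ?_, ?_, fun j => ?_⟩
  · intro a b hab
    have h1 := hdist a (by omega)
    have h2 := hdist b (by omega)
    simp only at hab
    rw [hab] at h1
    exact Fin.ext (h1.symm.trans h2)
  · intro a b hab
    exact Fin.ext (le_antisymm (key b a hab.symm) (key a b hab))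
  · exact ⟨(he j).1, by simpa using (he j).2.1, by simpa using (he j).2.2⟩

/-- The hypergraph on the whole type `V` whose edges are the members of the family. -/
def toHypergraph (E : ι → Finset V) : Hypergraph V where
  vertexSet := Set.univ
  edgeSet := Set.range fun i => (E i : Set V)
  subset_vertexSet_of_mem_edgeSet' _ _ := Set.subset_univ _

variable {E : ι → Finset V}

theorem hasPath_dist {x y : V} (hinj : Function.Injective E)
    (h : (shareGraph E Set.univ).Reachable x y) :
    (toHypergraph E).HasPath x y ((shareGraph E Set.univ).dist x y) := by
  obtain ⟨u, e, h0, h1, hu, he, hmem⟩ := exists_shortest h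
  exact ⟨u, fun j => (E (e j) : Set V), ⟨fun _ => trivial, fun j => ⟨e j, rfl⟩, hu,
    fun a b hab => he (hinj (Finset.coe_injective hab)), fun j => (hmem j).2.1,
    fun j => (hmem j).2.2⟩, h0, h1⟩

theorem exists_walk_of_hasPath {x y : V} {l : ℕ} (h : (toHypergraph E).HasPath x y l) :
    ∃ p : (shareGraph E Set.univ).Walk x y, p.length = l := by
  obtain ⟨u, e, hp, rfl, rfl⟩ := h
  have key : ∀ n (hn : n < l + 1),
      ∃ p : (shareGraph E Set.univ).Walk (u 0) (u ⟨n, hn⟩), p.length = n := by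
    intro n
    induction n with
    | zero => exact fun _ => ⟨SimpleGraph.Walk.nil, rfl⟩
    | succ n ih =>
      intro hn
      obtain ⟨p, hpl⟩ := ih (by omega)
      obtain ⟨i, hi⟩ := hp.edge_mem ⟨n, by omega⟩
      have h1 := hp.left_mem ⟨n, by omega⟩
      have h2 := hp.right_mem ⟨n, by omega⟩
      rw [← hi] at h1 h2
      have hadj : (shareGraph E Set.univ).Adj (u ⟨n, by omega⟩) (u ⟨n + 1, hn⟩) :=
        ⟨fun h => by simpa using hp.vertex_injective h, i, trivial, h1, h2⟩
      exact ⟨p.concat hadj, by simp [hpl]⟩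
  exact key l (by omega)

theorem pathDist_eq (hinj : Function.Injective E) {x y : V}
    (h : (shareGraph E Set.univ).Reachable x y) :
    (toHypergraph E).pathDist x y = (shareGraph E Set.univ).dist x y := by
  refine le_antisymm (Nat.sInf_le (hasPath_dist hinj h)) ?_
  refine le_csInf ⟨_, hasPath_dist hinj h⟩ ?_
  intro l hl
  obtain ⟨p, hp⟩ := exists_walk_of_hasPath hl
  exact hp ▸ SimpleGraph.dist_le p

theorem connected_of_isConnected (h : (toHypergraph E).IsConnected) :
    (shareGraph E Set.univ).Connected := by
  obtain ⟨v, -⟩ := h.1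
  have : Nonempty V := ⟨v⟩
  refine ⟨fun x y => ?_⟩
  obtain ⟨l, hl⟩ := h.2 x trivial y trivial
  exact (exists_walk_of_hasPath hl).choose.reachable

theorem isConnected_of_connected (hinj : Function.Injective E)
    (h : (shareGraph E Set.univ).Connected) : (toHypergraph E).IsConnected := by
  obtain ⟨v⟩ := h.nonempty
  exact ⟨⟨v, trivial⟩, fun x _ y _ => ⟨_, hasPath_dist hinj (h x y)⟩⟩

theorem bridge_of_isAcyclic (hinj : Function.Injective E) (h : (toHypergraph E).IsAcyclic)
    (i : ι) (x : V) (hx : x ∈ E i) (y : V) (hy : y ∈ E i) (hxy : x ≠ y) :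
    ¬ (shareGraph E {i}ᶜ).Reachable x y := by
  intro hr
  have hpos := hr.pos_dist_of_ne hxy
  obtain ⟨u, e, h0, h1, hu, he, hmem⟩ := exists_shortest hr
  generalize (shareGraph E {i}ᶜ).dist x y = l at u e hpos h0 h1 hu he hmem
  -- The geodesic from `x` to `y` avoiding `i`, closed up by the edge `i`, is a cycle; `x ≠ y` makes
  -- its length at least 2.
  refine h (l + 1) (Fin.snoc (α := fun _ => V) u x)
    (Fin.snoc (α := fun _ => Set V) (fun j => (E (e j) : Set V)) (E i)) ⟨by omega, ?_, ?_, ?_, ?_, ?_, ?_⟩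
  · have : (0 : Fin (l + 1 + 1)) = Fin.castSucc 0 := rfl
    rw [Fin.snoc_last, this, Fin.snoc_castSucc, h0]
  · intro j
    induction j using Fin.lastCases with
    | last => rw [Fin.snoc_last]; exact ⟨i, rfl⟩
    | cast j => rw [Fin.snoc_castSucc]; exact ⟨e j, rfl⟩
  · simp only [Fin.snoc_castSucc]
    exact hu
  · have hcoe : ∀ a b, (E a : Set V) = E b → a = b := fun a b hab =>
      hinj (Finset.coe_injective hab)
    intro a b hab
    induction a using Fin.lastCases with
    | last =>
      induction b using Fin.lastCases with
      | last => rfl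
      | cast b =>
        rw [Fin.snoc_last, Fin.snoc_castSucc] at hab
        exact absurd (hcoe _ _ hab).symm (hmem b).1
    | cast a =>
      induction b using Fin.lastCases with
      | last =>
        rw [Fin.snoc_last, Fin.snoc_castSucc] at hab
        exact absurd (hcoe _ _ hab) (hmem a).1
      | cast b =>
        rw [Fin.snoc_castSucc, Fin.snoc_castSucc] at hab
        rw [he (hcoe _ _ hab)]
  · intro j
    rw [Fin.snoc_castSucc]
    induction j using Fin.lastCases with
    | last => rw [Fin.snoc_last, h1]; exact hy
    | cast j => rw [Fin.snoc_castSucc]; exact (hmem j).2.1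
  · intro j
    induction j using Fin.lastCases with
    | last => rw [Fin.snoc_last, Fin.succ_last, Fin.snoc_last]; exact hx
    | cast j =>
      rw [Fin.snoc_castSucc, Fin.succ_castSucc, Fin.snoc_castSucc]; exact (hmem j).2.2

theorem isArboreal_of_isUniformSupertree (hinj : Function.Injective E) {k : ℕ}
    (h : (toHypergraph E).IsUniformSupertree k) : IsArboreal E :=
  ⟨connected_of_isConnected h.connected, bridge_of_isAcyclic hinj h.acyclic⟩

/-- A highest vertex of a cycle is the top of neither of its two cycle edges, since each contains
another cycle vertex, which would be higher. Both edges are then its parent edge. -/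
theorem Rooted.isAcyclic {v₀ : V} {h : V → ℕ} {top : ι → V} (hR : Rooted E v₀ h top) :
    (toHypergraph E).IsAcyclic := by
  intro l u e hc
  have hl := hc.two_le
  have : Nonempty (Fin l) := ⟨⟨0, by omega⟩⟩
  obtain ⟨j, hj⟩ := Finite.exists_max fun j : Fin l => h (u j.castSucc)
  have hsucc : ∀ i : Fin l, ∃ i' : Fin l, i' ≠ i ∧ u i.succ = u i'.castSucc := by
    intro i
    by_cases hi : (i : ℕ) + 1 < l
    · exact ⟨⟨i + 1, hi⟩, fun h => by simpa using congrArg Fin.val h, rfl⟩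
    · refine ⟨⟨0, by omega⟩, fun h => ?_, ?_⟩
      · have := congrArg Fin.val h
        simp only at this
        omega
      · have h1 : i.succ = Fin.last l := Fin.ext (by simp; omega)
        rw [h1, hc.closed]
        rfl
  have hpred : ∃ i : Fin l, i ≠ j ∧ u i.succ = u j.castSucc := by
    by_cases hj0 : (j : ℕ) = 0
    · refine ⟨⟨l - 1, by omega⟩, fun h => ?_, ?_⟩
      · have := congrArg Fin.val h
        simp only at this
        omega
      · have h1 : (⟨l - 1, by omega⟩ : Fin l).succ = Fin.last l := Fin.ext (by simp; omega)
        have h2 : j.castSucc = 0 := Fin.ext (by simpa using hj0)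
        rw [h1, h2, hc.closed]
    · refine ⟨⟨j - 1, by omega⟩, fun h => ?_, ?_⟩
      · have := congrArg Fin.val h
        simp only at this
        omega
      · congr 1
        exact Fin.ext (by simp; omega)
  obtain ⟨i, hij, hi⟩ := hpred
  obtain ⟨j', hj', hjs⟩ := hsucc j
  have hne : ∀ m : Fin l, ∀ w ∈ e m, w ≠ u j.castSucc → (∃ m' : Fin l, w = u m'.castSucc) →
      ∀ a, (E a : Set V) = e m → u j.castSucc ∈ e m → u j.castSucc ≠ top a := by
    rintro m w hw hwj ⟨m', rfl⟩ a ha hjm hja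
    have h1 := hR.height_eq a (u m'.castSucc) (by rw [← ha] at hw; exact hw) (hja ▸ hwj)
    have h2 := hj m'
    rw [← hja] at h1
    omega
  obtain ⟨a, ha⟩ := hc.edge_mem j
  obtain ⟨b, hb⟩ := hc.edge_mem i
  have hja := hc.left_mem j
  have hjb : u j.castSucc ∈ e i := hi ▸ hc.right_mem i
  have h1 := hne j _ (hc.right_mem j) (by
    rw [hjs]; exact fun h => hj' (hc.vertex_injective h)) ⟨j', hjs⟩ a ha hja
  have h2 := hne i _ (hc.left_mem i) (fun h => hij (hc.vertex_injective h)) ⟨i, rfl⟩ b hb hjb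
  have hab := hR.unique _ a b (by rw [← ha] at hja; exact hja) h1
    (by rw [← hb] at hjb; exact hjb) h2
  apply hij
  apply hc.edge_injective
  rw [← ha, ← hb, hab]

/-- After a rearrangement only connectivity has to be checked; acyclicity and distinctness of the
edges come from the count. -/
theorem isUniformSupertree_of_card [Fintype V] [Fintype ι] {k : ℕ} (hk2 : 2 ≤ k)
    (hk : ∀ i, (E i).card = k) (hconn : (shareGraph E Set.univ).Connected)
    (hcard : Fintype.card V = Fintype.card ι * (k - 1) + 1) :
    Function.Injective E ∧ (toHypergraph E).IsUniformSupertree k := by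
  obtain ⟨v₀⟩ := hconn.nonempty
  obtain ⟨top, hR⟩ := rooted_of_card hconn hk (by omega) hcard v₀
  have hinj := hR.injective fun i => (hk i).symm ▸ hk2
  refine ⟨hinj, rfl, ?_, isConnected_of_connected hinj hconn, hR.isAcyclic⟩
  rintro _ ⟨i, rfl⟩
  simp only [Set.encard_coe_eq_coe_finsetCard, hk i]

theorem exists_eq_toHypergraph [Fintype V] {H : Hypergraph V} (hH : H.vertexSet = Set.univ) :
    ∃ E : {s : Finset V // (s : Set V) ∈ H.edgeSet} → Finset V,
      Function.Injective E ∧ H = toHypergraph E := by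
  refine ⟨Subtype.val, Subtype.val_injective, Hypergraph.ext hH ?_⟩
  ext s
  constructor
  · intro hs
    exact ⟨⟨s.toFinset, by simpa using hs⟩, by simp⟩
  · rintro ⟨⟨t, ht⟩, rfl⟩
    exact ht

/-- The number of members of the family containing `v`. -/
noncomputable def degree [Fintype ι] (E : ι → Finset V) (v : V) : ℕ :=
  (Finset.univ.filter fun i => v ∈ E i).card

theorem vertexDegree_eq [Fintype ι] (hinj : Function.Injective E) (v : V) :
    (toHypergraph E).vertexDegree v = degree E v := by
  have : {e | e ∈ (toHypergraph E).edgeSet ∧ v ∈ e} =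
      (fun i => (E i : Set V)) '' {i | v ∈ E i} := by
    ext s
    constructor
    · rintro ⟨⟨i, rfl⟩, hv⟩
      exact ⟨i, hv, rfl⟩
    · rintro ⟨i, hv, rfl⟩
      exact ⟨⟨i, rfl⟩, hv⟩
  have hinj' : Function.Injective fun i => (E i : Set V) := Finset.coe_injective.comp hinj
  rw [Hypergraph.vertexDegree, this, Set.ncard_image_of_injective _ hinj', degree,
    ← Set.ncard_coe_finset]
  simp

end

/-! ### The spectral radius as the maximum of the form. -/

section

variable {V ι : Type*} [Fintype V]

/-! ### The signless Laplacian tensor -/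

omit [Fintype V] in
theorem injective_of_card_image {m : ℕ} {j : Fin m → V} {s : Finset V}
    (hj : Finset.univ.image j = s) (hs : s.card = m) : Function.Injective j := by
  have : (Finset.univ.image j).card = (Finset.univ : Finset (Fin m)).card := by simp [hj, hs]
  simpa using Finset.card_image_iff.1 this

theorem card_image_eq {s : Finset V} {m : ℕ} (hs : s.card = m) :
    (Finset.univ.filter fun j : Fin m → V => Finset.univ.image j = s).card = m.factorial := by
  have h1 : Fintype.card (Fin m ≃ s) = m.factorial := by
    have e : Fin m ≃ s := Fintype.equivOfCardEq (by simp [hs])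
    rw [Fintype.card_equiv e, Fintype.card_fin]
  rw [← h1, ← Finset.card_univ]
  symm
  refine Finset.card_bij (fun f _ a => (f a : V)) ?_ ?_ ?_
  · intro f _
    simp only [Finset.mem_filter, Finset.mem_univ, true_and]
    ext v
    simp only [Finset.mem_image, Finset.mem_univ, true_and]
    constructor
    · rintro ⟨a, rfl⟩
      exact (f a).2
    · intro hv
      exact ⟨f.symm ⟨v, hv⟩, by simp⟩
  · intro f _ g _ hfg
    ext a
    exact congrFun hfg a
  · intro j hj
    simp only [Finset.mem_filter, Finset.mem_univ, true_and] at hj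
    have hinj := injective_of_card_image hj hs
    have hmem : ∀ a, j a ∈ s := fun a => hj ▸ Finset.mem_image_of_mem j (Finset.mem_univ a)
    refine ⟨Equiv.ofBijective (fun a => ⟨j a, hmem a⟩) ⟨fun a b hab => hinj ?_, ?_⟩,
      Finset.mem_univ _, rfl⟩
    · simpa using hab
    · rintro ⟨v, hv⟩
      rw [← hj] at hv
      obtain ⟨a, -, rfl⟩ := Finset.mem_image.1 hv
      exact ⟨a, rfl⟩

theorem sum_prod_image {s : Finset V} {m : ℕ} (hs : s.card = m) (z : V → ℂ) :
    (∑ j : Fin m → V, if Finset.univ.image j = s then ∏ a, z (j a) else 0) =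
      m.factorial * ∏ v ∈ s, z v := by
  rw [← Finset.sum_filter, Finset.sum_congr rfl (g := fun _ => ∏ v ∈ s, z v), Finset.sum_const,
    card_image_eq hs, nsmul_eq_mul]
  intro j hj
  have hj' := (Finset.mem_filter.1 hj).2
  have hinj := injective_of_card_image hj' hs
  rw [← hj', Finset.prod_image hinj.injOn]

variable [Fintype ι] {E : ι → Finset V} {k : ℕ}

theorem adjacencyTensor_apply (hinj : Function.Injective E) (hk : ∀ i, (E i).card = k)
    (z : V → ℂ) (v : V) :
    ((toHypergraph E).adjacencyTensor k).apply z v =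
      ∑ i ∈ Finset.univ.filter (fun i => v ∈ E i), ∏ w ∈ (E i).erase v, z w := by
  -- A tuple of `k - 1` indices completes `v` to an edge only by avoiding `v`. Each edge then arises
  -- from `(k - 1)!` tuples, which cancels the coefficient of the tensor.
  have hiff : ∀ (j : Fin (k - 1) → V) (i : ι), v ∈ E i →
      (insert v (Set.range j) = (E i : Set V) ↔ Finset.univ.image j = (E i).erase v) := by
    intro j i hv
    have hins : insert v (Set.range j) = ((insert v (Finset.univ.image j) : Finset V) : Set V) := by
      simp
    rw [hins, Finset.coe_inj]
    have hpos : 0 < (E i).card := Finset.card_pos.2 ⟨v, hv⟩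
    have hle : (Finset.univ.image j).card ≤ k - 1 := by
      simpa using Finset.card_image_le (s := Finset.univ) (f := j)
    constructor
    · intro h
      rw [← h, Finset.erase_insert]
      intro hvj
      rw [Finset.insert_eq_of_mem hvj] at h
      rw [h, hk i] at hle
      rw [hk i] at hpos
      omega
    · intro h
      rw [h, Finset.insert_erase hv]
  have hsplit : ∀ j : Fin (k - 1) → V,
      (toHypergraph E).adjacencyTensor k v j * ∏ s, z (j s) =
        ∑ i ∈ Finset.univ.filter (fun i => v ∈ E i), (1 / ((k - 1).factorial : ℂ)) *
          if Finset.univ.image j = (E i).erase v then ∏ s, z (j s) else 0 := by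
    intro j
    rw [Hypergraph.adjacencyTensor]
    split_ifs with h
    · obtain ⟨i, hi⟩ := h
      have hv : v ∈ E i := by
        have h' : v ∈ insert v (Set.range j) := Set.mem_insert v _
        rw [← hi] at h'
        exact h'
      rw [Finset.sum_eq_single_of_mem i (by simp [hv]), if_pos ((hiff j i hv).1 hi.symm)]
      intro i' hi' hne
      have hv' := (Finset.mem_filter.1 hi').2
      rw [if_neg, mul_zero]
      intro h'
      exact hne (hinj (Finset.coe_injective (((hiff j i' hv').2 h').symm.trans hi.symm)))
    · rw [zero_mul, Finset.sum_eq_zero]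
      intro i hi
      have hv := (Finset.mem_filter.1 hi).2
      rw [if_neg, mul_zero]
      exact fun h' => h ⟨i, ((hiff j i hv).2 h').symm⟩
  rw [Hypergraph.Tensor.apply]
  simp only [hsplit]
  rw [Finset.sum_comm]
  refine Finset.sum_congr rfl fun i hi => ?_
  have hv := (Finset.mem_filter.1 hi).2
  rw [← Finset.mul_sum, sum_prod_image (by rw [Finset.card_erase_of_mem hv, hk i])]
  rw [← mul_assoc, one_div, inv_mul_cancel₀ (by exact_mod_cast (k - 1).factorial_ne_zero), one_mul]

theorem degreeTensor_apply (hinj : Function.Injective E) (z : V → ℂ) (v : V) :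
    ((toHypergraph E).degreeTensor k).apply z v = degree E v * z v ^ (k - 1) := by
  rw [Hypergraph.Tensor.apply, Finset.sum_eq_single (fun _ => v)]
  · simp [Hypergraph.degreeTensor, vertexDegree_eq hinj]
  · intro j _ hj
    rw [Hypergraph.degreeTensor, if_neg, zero_mul]
    exact fun h => hj (funext h)
  · simp

theorem signlessLaplacianTensor_apply (hinj : Function.Injective E) (hk : ∀ i, (E i).card = k)
    (z : V → ℂ) (v : V) :
    ((toHypergraph E).signlessLaplacianTensor k).apply z v = degree E v * z v ^ (k - 1) +
      ∑ i ∈ Finset.univ.filter (fun i => v ∈ E i), ∏ w ∈ (E i).erase v, z w := by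
  rw [← degreeTensor_apply hinj, ← adjacencyTensor_apply hinj hk]
  simp only [Hypergraph.Tensor.apply, Hypergraph.signlessLaplacianTensor, add_mul,
    Finset.sum_add_distrib]

/-! ### The signless Laplacian form -/

/-- The contribution `∑_{v ∈ e} x_v ^ k + k ∏_{v ∈ e} x_v` of an edge to `Q x ^ k`. -/
noncomputable def edgeForm (k : ℕ) (e : Finset V) (x : V → ℝ) : ℝ :=
  ∑ v ∈ e, x v ^ k + k * ∏ v ∈ e, x v

/-- The form `Q x ^ k` of the signless Laplacian tensor. -/
noncomputable def form (E : ι → Finset V) (k : ℕ) (x : V → ℝ) : ℝ := ∑ i, edgeForm k (E i) x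

/-- The product of `x v` with the `v`-th component of `Q x ^ (k - 1)`. -/
noncomputable def row (E : ι → Finset V) (k : ℕ) (x : V → ℝ) (v : V) : ℝ :=
  ∑ i ∈ Finset.univ.filter (fun i => v ∈ E i), (x v ^ k + ∏ w ∈ E i, x w)

theorem sum_row (hk : ∀ i, (E i).card = k) (x : V → ℝ) : ∑ v, row E k x v = form E k x := by
  simp only [row, form, edgeForm, Finset.sum_filter]
  rw [Finset.sum_comm]
  refine Finset.sum_congr rfl fun i _ => ?_
  rw [← Finset.sum_filter, Finset.filter_mem_eq_inter, Finset.univ_inter, Finset.sum_add_distrib,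
    Finset.sum_const, hk i, nsmul_eq_mul]

omit [Fintype V] in
theorem row_eq (hk0 : k ≠ 0) (x : V → ℝ) (v : V) :
    row E k x v = x v * (degree E v * x v ^ (k - 1) +
      ∑ i ∈ Finset.univ.filter (fun i => v ∈ E i), ∏ w ∈ (E i).erase v, x w) := by
  rw [row, Finset.sum_add_distrib, Finset.sum_const, nsmul_eq_mul, mul_add, Finset.mul_sum, degree,
    ← mul_pow_sub_one hk0 (x v)]
  congr 1
  · ring
  · exact Finset.sum_congr rfl fun i hi =>
      (Finset.mul_prod_erase _ _ (Finset.mem_filter.1 hi).2).symm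

omit [Fintype V] in
theorem form_smul (hk : ∀ i, (E i).card = k) (c : ℝ) (x : V → ℝ) :
    form E k (fun v => c * x v) = c ^ k * form E k x := by
  simp only [form, edgeForm, mul_pow, Finset.prod_mul_distrib, Finset.prod_const, hk,
    Finset.mul_sum, mul_add]
  refine Finset.sum_congr rfl fun i _ => ?_
  ring

omit [Fintype V] in
theorem continuous_form : Continuous (form E k) := by
  unfold form edgeForm
  fun_prop

omit [Fintype V] in
theorem edgeForm_mono {e : Finset V} {x y : V → ℝ} (hx : ∀ v, 0 ≤ x v) (hxy : ∀ v, x v ≤ y v) :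
    edgeForm k e x ≤ edgeForm k e y := by
  unfold edgeForm
  gcongr with v _ v _
  · exact hx v
  · exact hxy v
  · exact fun v _ => hx v
  · exact hxy v

/-- The nonnegative part of the unit sphere is compact; homogeneity of degree `k` extends the bound
to all nonnegative vectors. -/
theorem exists_maximizer [Nonempty V] (hk : ∀ i, (E i).card = k) (hk0 : k ≠ 0) :
    ∃ x : V → ℝ, (∀ v, 0 ≤ x v) ∧ ∑ v, x v ^ k = 1 ∧
      ∀ y : V → ℝ, (∀ v, 0 ≤ y v) → form E k y ≤ form E k x * ∑ v, y v ^ k := by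
  have hcomp : IsCompact {x : V → ℝ | (∀ v, 0 ≤ x v) ∧ ∑ v, x v ^ k = 1} := by
    refine (isCompact_Icc (a := (0 : V → ℝ)) (b := 1)).of_isClosed_subset ?_ ?_
    · refine IsClosed.and ?_ ?_
      · exact isClosed_le continuous_const continuous_id
      · exact isClosed_eq (by fun_prop) continuous_const
    · rintro x ⟨h0, h1⟩
      refine ⟨h0, fun v => ?_⟩
      have h2 := Finset.single_le_sum (f := fun v => x v ^ k)
        (fun v _ => pow_nonneg (h0 v) k) (Finset.mem_univ v)
      simp only [h1] at h2
      exact (pow_le_one_iff_of_nonneg (h0 v) hk0).1 h2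
  have hne : {x : V → ℝ | (∀ v, 0 ≤ x v) ∧ ∑ v, x v ^ k = 1}.Nonempty := by
    obtain ⟨v₀⟩ := ‹Nonempty V›
    refine ⟨Pi.single v₀ 1, fun v => ?_, ?_⟩
    · by_cases h : v = v₀
      · subst h; simp
      · simp [h]
    · rw [Finset.sum_eq_single v₀]
      · simp
      · intro v _ h; simp [h, hk0]
      · simp
  obtain ⟨x, ⟨h0, h1⟩, hmax⟩ := hcomp.exists_isMaxOn hne
    (continuous_form (E := E) (k := k)).continuousOn
  refine ⟨x, h0, h1, fun y hy => ?_⟩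
  have hs0 : 0 ≤ ∑ v, y v ^ k := Finset.sum_nonneg fun v _ => pow_nonneg (hy v) k
  rcases hs0.eq_or_lt with hs | hs
  · have hy0 : ∀ v, y v = 0 := fun v => by
      have := (Finset.sum_eq_zero_iff_of_nonneg (s := Finset.univ) (f := fun v => y v ^ k)
        fun v _ => pow_nonneg (hy v) k).1 hs.symm v (Finset.mem_univ v)
      exact pow_eq_zero_iff hk0 |>.1 this
    have h2 : form E k y = 0 := by
      have := form_smul (E := E) hk 0 y
      rwa [zero_pow hk0, zero_mul, show (fun v => 0 * y v) = y from
        funext fun v => by rw [hy0, mul_zero]] at this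
    rw [h2, ← hs, mul_zero]
  · set s := ∑ v, y v ^ k with hsdef
    obtain ⟨c, hc, hck⟩ : ∃ c : ℝ, 0 ≤ c ∧ c ^ k = s⁻¹ :=
      ⟨s⁻¹ ^ ((k : ℝ)⁻¹), by positivity, Real.rpow_inv_natCast_pow (by positivity) hk0⟩
    have h3 : form E k (fun v => c * y v) ≤ form E k x := by
      refine hmax ⟨fun v => mul_nonneg hc (hy v), ?_⟩
      simp only [mul_pow, ← Finset.mul_sum]
      rw [hck, ← hsdef, inv_mul_cancel₀ hs.ne']
    rw [form_smul hk, hck, inv_mul_le_iff₀ hs] at h3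
    linarith

/-- If `x` vanished somewhere, connectivity would give an edge with both zero and nonzero entries.
Raising all zeros to `t` gains at least a multiple of `t ^ (k - 1)` on that edge, while `q * ∑ y ^
k` grows only by a multiple of `t ^ k`. -/
theorem pos_of_maximizer (hconn : (shareGraph E Set.univ).Connected) (hk : ∀ i, (E i).card = k)
    (hk2 : 2 ≤ k) {x : V → ℝ} (h0 : ∀ v, 0 ≤ x v) (h1 : ∑ v, x v ^ k = 1)
    (hmax : ∀ y : V → ℝ, (∀ v, 0 ≤ y v) → form E k y ≤ form E k x * ∑ v, y v ^ k) (v : V) :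
    0 < x v := by
  by_contra hv
  have hv0 : x v = 0 := le_antisymm (not_lt.1 hv) (h0 v)
  obtain ⟨w, hw⟩ : ∃ w, x w ≠ 0 := by
    by_contra hall
    push Not at hall
    simp [hall, show k ≠ 0 by omega] at h1
  obtain ⟨i, a, ha, b, hb, hxa, hxb⟩ : ∃ i, ∃ a ∈ E i, ∃ b ∈ E i, x a = 0 ∧ x b ≠ 0 := by
    by_contra hno
    push Not at hno
    have : ∀ u u', (shareGraph E Set.univ).Reachable u u' → x u = 0 → x u' = 0 := by
      rintro u u' ⟨p⟩
      induction p with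
      | nil => exact id
      | cons hadj _ ih =>
        obtain ⟨_, i, -, h1, h2⟩ := hadj
        exact fun hu => ih (hno i _ h1 _ h2 hu)
    exact hw (this v w (hconn v w) hv0)
  set q := form E k x with hq
  set c := ∏ u ∈ (E i).filter (fun u => x u ≠ 0), x u with hc
  have hcpos : 0 < c := Finset.prod_pos fun u hu =>
    (h0 u).lt_of_ne (Finset.mem_filter.1 hu).2.symm
  have hq0 : 0 ≤ q := Finset.sum_nonneg fun j _ => add_nonneg
    (Finset.sum_nonneg fun u _ => pow_nonneg (h0 u) k)
    (mul_nonneg (Nat.cast_nonneg k) (Finset.prod_nonneg fun u _ => h0 u))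
  set N : ℝ := ∑ u : V, if x u = 0 then (1 : ℝ) else 0 with hN
  have hN0 : 0 ≤ N := Finset.sum_nonneg fun u _ => by split_ifs <;> norm_num
  have hkey : ∀ t : ℝ, 0 < t → t ≤ 1 → c ≤ q * N * t := by
    intro t ht ht1
    set y : V → ℝ := fun u => if x u = 0 then t else x u with hy
    have hxy : ∀ u, x u ≤ y u := fun u => by
      simp only [hy]; split_ifs with h
      · rw [h]; exact ht.le
      · exact le_rfl
    have hsum : ∑ u, y u ^ k = 1 + N * t ^ k := by
      rw [← h1, hN, Finset.sum_mul, ← Finset.sum_add_distrib]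
      refine Finset.sum_congr rfl fun u _ => ?_
      simp only [hy]; split_ifs with h
      · rw [h, zero_pow (by omega)]; ring
      · ring
    have hform : q + c * t ^ (k - 1) ≤ form E k y := by
      have h2 : edgeForm k (E i) y - edgeForm k (E i) x ≤ form E k y - q := by
        rw [hq, form, form, ← Finset.sum_sub_distrib]
        exact Finset.single_le_sum (f := fun j => edgeForm k (E j) y - edgeForm k (E j) x)
          (fun j _ => sub_nonneg.2 (edgeForm_mono h0 hxy)) (Finset.mem_univ i)
      have h3 : ∏ u ∈ E i, x u = 0 := Finset.prod_eq_zero ha hxa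
      have h4 : ∑ u ∈ E i, x u ^ k ≤ ∑ u ∈ E i, y u ^ k :=
        Finset.sum_le_sum fun u _ => pow_le_pow_left₀ (h0 u) (hxy u) k
      have h5 : c * t ^ (k - 1) ≤ ∏ u ∈ E i, y u := by
        rw [← Finset.prod_filter_mul_prod_filter_not (E i) (fun u => x u ≠ 0)]
        have h6 : ∏ u ∈ (E i).filter (fun u => x u ≠ 0), y u = c :=
          Finset.prod_congr rfl fun u hu => by simp [hy, (Finset.mem_filter.1 hu).2]
        have h7 : ∏ u ∈ (E i).filter (fun u => ¬ x u ≠ 0), y u =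
            t ^ ((E i).filter (fun u => ¬ x u ≠ 0)).card := by
          rw [← Finset.prod_const]
          refine Finset.prod_congr rfl fun u hu => ?_
          have := (Finset.mem_filter.1 hu).2
          push Not at this
          simp [hy, this]
        rw [h6, h7]
        refine mul_le_mul_of_nonneg_left (pow_le_pow_of_le_one ht.le ht1 ?_) hcpos.le
        have : (E i).filter (fun u => ¬ x u ≠ 0) ⊂ E i :=
          Finset.filter_ssubset.2 ⟨b, hb, not_not.2 hxb⟩
        have := Finset.card_lt_card this
        rw [hk i] at this
        omega
      have h8 : ∏ u ∈ E i, y u ≤ k * ∏ u ∈ E i, y u :=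
        le_mul_of_one_le_left (Finset.prod_nonneg fun u _ => (h0 u).trans (hxy u))
          (by exact_mod_cast (by omega : 1 ≤ k))
      simp only [edgeForm, h3, mul_zero] at h2
      linarith
    have h9 := hform.trans (hmax y fun u => (h0 u).trans (hxy u))
    rw [hsum] at h9
    have h10 : c * t ^ (k - 1) ≤ q * N * t * t ^ (k - 1) := by
      have : t ^ k = t * t ^ (k - 1) := (mul_pow_sub_one (by omega) t).symm
      rw [this] at h9
      linarith
    exact le_of_mul_le_mul_right h10 (pow_pos ht _)
  have hqN : 0 ≤ q * N := mul_nonneg hq0 hN0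
  -- This `t` lies in `(0, 1]` and makes `q * N * t < c`.
  have h11 := hkey (c / (q * N + c)) (by positivity)
    (by rw [div_le_one (by positivity)]; linarith)
  rw [← mul_div_assoc, le_div_iff₀ (by positivity)] at h11
  nlinarith

omit [Fintype V] in
theorem edgeForm_update_of_mem {e : Finset V} {v : V} (hv : v ∈ e) (x : V → ℝ) (t : ℝ) :
    edgeForm k e (Function.update x v t) =
      ∑ w ∈ e.erase v, x w ^ k + (t ^ k + k * (t * ∏ w ∈ e.erase v, x w)) := by
  rw [edgeForm, ← Finset.add_sum_erase _ _ hv, ← Finset.mul_prod_erase _ _ hv,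
    Function.update_self,
    Finset.sum_congr rfl fun w hw => by rw [Function.update_of_ne (Finset.ne_of_mem_erase hw)],
    Finset.prod_congr rfl fun w hw => by rw [Function.update_of_ne (Finset.ne_of_mem_erase hw)]]
  ring

omit [Fintype V] in
theorem edgeForm_update_of_notMem {e : Finset V} {v : V} (hv : v ∉ e) (x : V → ℝ) (t : ℝ) :
    edgeForm k e (Function.update x v t) = edgeForm k e x := by
  rw [edgeForm, edgeForm,
    Finset.sum_congr rfl fun w hw => by rw [Function.update_of_ne (ne_of_mem_of_not_mem hw hv)],
    Finset.prod_congr rfl fun w hw => by rw [Function.update_of_ne (ne_of_mem_of_not_mem hw hv)]]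

/-- First-order condition in the single coordinate `v`: the form minus `q * ∑ x ^ k` is nonpositive
on nonnegative vectors and zero at `x`, and `x v > 0` makes this an interior maximum. Each edge
product is linear in `x v`. -/
theorem row_eq_of_maximizer (hk0 : k ≠ 0) {q : ℝ} {x : V → ℝ} (hx : ∀ v, 0 < x v)
    (hq : form E k x = q * ∑ v, x v ^ k)
    (hmax : ∀ y : V → ℝ, (∀ v, 0 ≤ y v) → form E k y ≤ q * ∑ v, y v ^ k) (v : V) :
    row E k x v = q * x v ^ k := by
  set R := ∑ i ∈ Finset.univ.filter (fun i => v ∈ E i), ∏ w ∈ (E i).erase v, x w with hR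
  obtain ⟨A, hA⟩ : ∃ A, ∀ t, form E k (Function.update x v t) =
      A + (degree E v * t ^ k + k * (t * R)) := by
    refine ⟨∑ i, if v ∈ E i then ∑ w ∈ (E i).erase v, x w ^ k else edgeForm k (E i) x,
      fun t => ?_⟩
    have : (degree E v * t ^ k + k * (t * R) : ℝ) =
        ∑ i, if v ∈ E i then t ^ k + k * (t * ∏ w ∈ (E i).erase v, x w) else 0 := by
      rw [← Finset.sum_filter, Finset.sum_add_distrib, Finset.sum_const, nsmul_eq_mul, hR, degree,
        Finset.mul_sum, Finset.mul_sum]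
    rw [this, ← Finset.sum_add_distrib, form]
    refine Finset.sum_congr rfl fun i _ => ?_
    split_ifs with h
    · exact edgeForm_update_of_mem h x t
    · rw [edgeForm_update_of_notMem h, add_zero]
  obtain ⟨B, hB⟩ : ∃ B, ∀ t, ∑ w, (Function.update x v t) w ^ k = B + t ^ k := by
    refine ⟨∑ w ∈ Finset.univ.erase v, x w ^ k, fun t => ?_⟩
    rw [← Finset.sum_erase_add _ _ (Finset.mem_univ v), Function.update_self,
      Finset.sum_congr rfl fun w hw => by rw [Function.update_of_ne (Finset.ne_of_mem_erase hw)]]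
  have hA' := hA (x v)
  have hB' := hB (x v)
  rw [Function.update_eq_self] at hA' hB'
  set F : ℝ → ℝ := fun t => (degree E v * t ^ k + k * (t * R)) - q * t ^ k with hF
  have hloc : IsLocalMax F (x v) := by
    filter_upwards [lt_mem_nhds (hx v)] with t ht
    have h1 := hmax (Function.update x v t) (fun w => by
      by_cases h : w = v
      · subst h; rw [Function.update_self]; exact ht.le
      · rw [Function.update_of_ne h]; exact (hx w).le)
    rw [hA, hB] at h1
    rw [hA', hB'] at hq
    simp only [hF]
    linarith
  have hder : HasDerivAt F ((degree E v * (k * x v ^ (k - 1)) + k * (1 * R)) -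
      q * (k * x v ^ (k - 1))) (x v) := by
    have hp : HasDerivAt (fun t : ℝ => t ^ k) (k * x v ^ (k - 1)) (x v) := hasDerivAt_pow k (x v)
    exact ((hp.const_mul _).add (((hasDerivAt_id (x v)).mul_const R).const_mul _)).sub
      (hp.const_mul q)
  have hzero := hloc.hasDerivAt_eq_zero hder
  have hk' : (k : ℝ) ≠ 0 := by exact_mod_cast hk0
  have h2 : degree E v * x v ^ (k - 1) + R = q * x v ^ (k - 1) := by
    have : (k : ℝ) * (degree E v * x v ^ (k - 1) + R - q * x v ^ (k - 1)) = 0 := by linarith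
    have := (mul_eq_zero.1 this).resolve_left hk'
    linarith
  rw [row_eq hk0, h2, ← mul_pow_sub_one hk0 (x v)]
  ring

/-- Triangle inequality in each eigenvalue equation, multiplied by `‖z v‖` and summed. Together with
the maximum property it bounds every eigenvalue. -/
theorem norm_mul_sum_le (hinj : Function.Injective E) (hk : ∀ i, (E i).card = k) (hk0 : k ≠ 0)
    {z : V → ℂ} {μ : ℂ}
    (hz : ∀ v, ((toHypergraph E).signlessLaplacianTensor k).apply z v = μ * z v ^ (k - 1)) :
    ‖μ‖ * ∑ v, ‖z v‖ ^ k ≤ form E k (fun v => ‖z v‖) := by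
  rw [← sum_row hk, Finset.mul_sum]
  refine Finset.sum_le_sum fun v _ => ?_
  rw [row_eq hk0, ← mul_pow_sub_one hk0 ‖z v‖, mul_left_comm]
  refine mul_le_mul_of_nonneg_left ?_ (norm_nonneg _)
  rw [← norm_pow, ← norm_mul, ← hz v, signlessLaplacianTensor_apply hinj hk]
  refine (norm_add_le _ _).trans (add_le_add ?_ ?_)
  · rw [norm_mul, Complex.norm_natCast]
  · refine (norm_sum_le _ _).trans (Finset.sum_le_sum fun i _ => ?_)
    rw [norm_prod]

theorem signlessSpectralRadius_spec (hconn : (shareGraph E Set.univ).Connected)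
    (hinj : Function.Injective E) (hk : ∀ i, (E i).card = k) (hk2 : 2 ≤ k) :
    (∀ y : V → ℝ, (∀ v, 0 ≤ y v) →
      form E k y ≤ (toHypergraph E).signlessSpectralRadius k * ∑ v, y v ^ k) ∧
    ∃ x : V → ℝ, (∀ v, 0 < x v) ∧
      form E k x = (toHypergraph E).signlessSpectralRadius k * ∑ v, x v ^ k := by
  have hk0 : k ≠ 0 := by omega
  have := hconn.nonempty
  obtain ⟨x, h0, h1, hmax⟩ := exists_maximizer (E := E) hk hk0
  have hpos := pos_of_maximizer hconn hk hk2 h0 h1 hmax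
  have hrow := row_eq_of_maximizer hk0 hpos (by rw [h1, mul_one]) hmax
  set q := form E k x with hq
  have hq0 : 0 ≤ q := Finset.sum_nonneg fun j _ => add_nonneg
    (Finset.sum_nonneg fun u _ => pow_nonneg (h0 u) k)
    (mul_nonneg (Nat.cast_nonneg k) (Finset.prod_nonneg fun u _ => h0 u))
  have hrad : (toHypergraph E).signlessSpectralRadius k = q := by
    refine IsGreatest.csSup_eq ⟨⟨(q : ℂ), ⟨fun v => (x v : ℂ), ?_, fun v => ?_⟩, ?_⟩, ?_⟩
    · intro h
      obtain ⟨v⟩ := this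
      exact (hpos v).ne' (by simpa using congrFun h v)
    · rw [signlessLaplacianTensor_apply hinj hk]
      have h2 := hrow v
      rw [row_eq hk0, ← mul_pow_sub_one hk0 (x v), mul_left_comm] at h2
      have h3 := congrArg ((↑) : ℝ → ℂ) (mul_left_cancel₀ (hpos v).ne' h2)
      push_cast at h3
      exact h3
    · rw [Complex.norm_real, Real.norm_of_nonneg hq0]
    · rintro r ⟨μ, ⟨z, hz0, hz⟩, rfl⟩
      obtain ⟨w, hw⟩ := Function.ne_iff.1 hz0
      have h3 := (norm_mul_sum_le hinj hk hk0 hz).trans (hmax _ fun v => norm_nonneg _)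
      refine le_of_mul_le_mul_right h3 ?_
      exact Finset.sum_pos' (fun v _ => by positivity)
        ⟨w, Finset.mem_univ _, pow_pos (norm_pos_iff.2 hw) k⟩
  rw [hrad]
  exact ⟨hmax, x, hpos, by rw [h1, mul_one]⟩

end

/-! ### Rearrangements of an extremal family. -/

section

variable {V ι : Type*}

theorem Rooted.descend {E : ι → Finset V} {v₀ : V} {h : V → ℕ} {top : ι → V}
    (hR : Rooted E v₀ h top) (z : V) :
    (shareGraph E {j | h (top j) < h z}).Reachable z v₀ := by
  induction hn : h z using Nat.strong_induction_on generalizing z with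
  | _ n ih =>
    by_cases hz : z = v₀
    · rw [hz]
    · obtain ⟨j, h1, h2⟩ := hR.exists_edge z hz
      have h3 := hR.height_eq j z h1 h2
      refine (reachable_of_mem (i := j) ?_ h1 (hR.top_mem j)).trans
        (Reachable.mono ?_ (ih _ (by omega) (top j) rfl))
      · simp only [Set.mem_ofPred_eq]; omega
      · intro l hl
        simp only [Set.mem_ofPred_eq] at hl ⊢
        omega

/-- The climb from `z` is stopped at the first vertex whose parent edge is `i`, if there is one.
This locates the end on `i` of the path joining it to another edge. -/
theorem Rooted.descend_avoiding {E : ι → Finset V} {v₀ : V} {h : V → ℕ} {top : ι → V}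
    (hR : Rooted E v₀ h top) (i : ι) (z : V) :
    (shareGraph E {j | h (top j) < h z ∧ j ≠ i}).Reachable z v₀ ∨
      ∃ y ∈ E i, y ≠ top i ∧ (shareGraph E {j | h (top j) < h z ∧ j ≠ i}).Reachable z y := by
  induction hn : h z using Nat.strong_induction_on generalizing z with
  | _ n ih =>
    by_cases hz : z = v₀
    · left; rw [hz]
    · obtain ⟨j, h1, h2⟩ := hR.exists_edge z hz
      have h3 := hR.height_eq j z h1 h2
      by_cases hji : j = i
      · subst hji
        exact Or.inr ⟨z, h1, h2, SimpleGraph.Reachable.refl _⟩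
      · have hstep : (shareGraph E {j | h (top j) < n ∧ j ≠ i}).Reachable z (top j) := by
          refine reachable_of_mem (i := j) ?_ h1 (hR.top_mem j)
          simp only [Set.mem_ofPred_eq]
          exact ⟨by omega, hji⟩
        have hsub : {l | h (top l) < h (top j) ∧ l ≠ i} ⊆ {l | h (top l) < n ∧ l ≠ i} := by
          intro l hl
          simp only [Set.mem_ofPred_eq] at hl ⊢
          exact ⟨by omega, hl.2⟩
        rcases ih _ (by omega) (top j) rfl with h4 | ⟨y, hy, hyt, h4⟩
        · exact Or.inl (hstep.trans (Reachable.mono hsub h4))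
        · exact Or.inr ⟨y, hy, hyt, hstep.trans (Reachable.mono hsub h4)⟩

/-- A common vertex other than `a` would be joined to `a` without `e`, through `f` and the path back
from `b`, against the bridge property; likewise for `b`. -/
theorem IsArboreal.eq_of_mem_of_mem {E : ι → Finset V} (hE : IsArboreal E) {e f : ι} (hef : e ≠ f)
    {a b : V} (ha : a ∈ E e) (hb : b ∈ E f) (hab : (shareGraph E {e, f}ᶜ).Reachable a b)
    {p : V} (hpe : p ∈ E e) (hpf : p ∈ E f) : p = a ∧ p = b := by
  constructor
  · by_contra hpa
    refine hE.bridge e p hpe a ha hpa ((reachable_of_mem (i := f) hef.symm hpf hb).trans ?_)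
    exact (Reachable.mono (by simp) hab).symm
  · by_contra hpb
    refine hE.bridge f p hpf b hb hpb ((reachable_of_mem (i := e) hef hpe ha).trans ?_)
    exact Reachable.mono (by simp) hab

theorem sum_add_eq_of_eq_off {M : Type*} [AddCommMonoid M] [Fintype ι] {E E' : ι → Finset V}
    {e f : ι} (hef : e ≠ f) (h : ∀ i, i ≠ e → i ≠ f → E' i = E i) (F : Finset V → M) :
    ∑ i, F (E' i) + (F (E e) + F (E f)) = ∑ i, F (E i) + (F (E' e) + F (E' f)) := by
  have hf : f ∈ Finset.univ.erase e := by simp [hef.symm]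
  rw [← Finset.add_sum_erase _ _ (Finset.mem_univ e), ← Finset.add_sum_erase _ _ hf,
    ← Finset.add_sum_erase _ (fun i => F (E i)) (Finset.mem_univ e),
    ← Finset.add_sum_erase _ (fun i => F (E i)) hf,
    Finset.sum_congr rfl fun i hi => by
      rw [h i (Finset.ne_of_mem_erase (Finset.mem_of_mem_erase hi)) (Finset.ne_of_mem_erase hi)]]
  abel

variable [Fintype V] [Fintype ι] {E : ι → Finset V} {k : ℕ} {x : V → ℝ}

/-- The positive vector `x` is such that every supertree with the same degree sequence whose form
at `x` is at least that of `E` satisfies the same eigenvalue equations at `x`. -/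
structure IsExtremal (E : ι → Finset V) (k : ℕ) (x : V → ℝ) : Prop where
  pos : ∀ v, 0 < x v
  row_eq : ∀ E' : ι → Finset V, (∀ i, (E' i).card = k) → (shareGraph E' Set.univ).Connected →
    (∃ σ : Equiv.Perm V, ∀ v, degree E' (σ v) = degree E v) → form E k x ≤ form E' k x →
    ∀ v, row E' k x v = row E k x v

omit [Fintype V] in
theorem degree_eq_sum (E : ι → Finset V) (v : V) :
    degree E v = ∑ i, if v ∈ E i then 1 else 0 := by
  rw [degree, Finset.card_filter]

omit [Fintype V] in
-- Exchange `p` and `q`. If `A > B`, the form does not drop, so the eigenvalue equation at `p`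
-- persists; but its term `x p * A` has become `x p * B`.
theorem IsExtremal.prod_erase_le (hx : IsExtremal E k x) (hE : IsArboreal E)
    (hk : ∀ i, (E i).card = k) (hk2 : 2 ≤ k) {e f : ι} (hef : e ≠ f) {a b p q : V}
    (ha : a ∈ E e) (hb : b ∈ E f) (hab : (shareGraph E {e, f}ᶜ).Reachable a b)
    (hpe : p ∈ E e) (hqf : q ∈ E f) (hpf : p ∉ E f) (hqe : q ∉ E e)
    (hpq : (p ≠ a ∧ q ≠ b) ∨ (p = a ∧ q = b)) (hle : x p ≤ x q) :
    ∏ w ∈ (E e).erase p, x w ≤ ∏ w ∈ (E f).erase q, x w := by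
  by_contra hlt
  push Not at hlt
  set A := ∏ w ∈ (E e).erase p, x w with hA
  set B := ∏ w ∈ (E f).erase q, x w with hB
  have hne : p ≠ q := fun h => hpf (h ▸ hqf)
  obtain ⟨E', he', hf', hoff⟩ : ∃ E' : ι → Finset V, E' e = insert q ((E e).erase p) ∧
      E' f = insert p ((E f).erase q) ∧ ∀ i, i ≠ e → i ≠ f → E' i = E i :=
    ⟨fun i => if i = e then insert q ((E e).erase p) else
      if i = f then insert p ((E f).erase q) else E i, by simp, by simp [hef.symm],
      fun i h1 h2 => by simp [h1, h2]⟩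
  have hqe' : q ∉ (E e).erase p := fun h => hqe (Finset.mem_of_mem_erase h)
  have hpf' : p ∉ (E f).erase q := fun h => hpf (Finset.mem_of_mem_erase h)
  have hcard : ∀ i, (E' i).card = k := by
    intro i
    by_cases h1 : i = e
    · rw [h1, he', Finset.card_insert_of_notMem hqe', Finset.card_erase_of_mem hpe, hk]
      omega
    · by_cases h2 : i = f
      · rw [h2, hf', Finset.card_insert_of_notMem hpf', Finset.card_erase_of_mem hqf, hk]
        omega
      · rw [hoff i h1 h2, hk]
  have hdeg : ∀ v, degree E' v = degree E v := by
    intro v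
    have h1 := sum_add_eq_of_eq_off hef hoff fun s => if v ∈ s then 1 else 0
    rw [← degree_eq_sum, ← degree_eq_sum, he', hf'] at h1
    have h2 : ((if v ∈ insert q ((E e).erase p) then 1 else 0) +
        if v ∈ insert p ((E f).erase q) then 1 else 0) =
        (if v ∈ E e then 1 else 0) + if v ∈ E f then 1 else 0 := by
      by_cases hvp : v = p
      · subst hvp; simp [hne, hpe, hpf]
      · by_cases hvq : v = q
        · subst hvq; simp [hvp, hqf, hqe]
        · simp [hvp, hvq]
    omega
  -- The path from `a` to `b` is untouched. Its ends either stay in their edges or trade edges with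
  -- each other, so it still joins the two new edges.
  have hconn : (shareGraph E' Set.univ).Connected := by
    have hab' : (shareGraph E' Set.univ).Reachable a b := by
      refine Reachable.transfer ?_ hab
      intro i hi u hu w hw
      simp only [Set.mem_compl_iff, Set.mem_insert_iff, Set.mem_singleton_iff, not_or] at hi
      rw [← hoff i hi.1 hi.2] at hu hw
      exact reachable_of_mem (Set.mem_univ i) hu hw
    have hall : (∀ z ∈ E' e, (shareGraph E' Set.univ).Reachable a z) ∧
        ∀ z ∈ E' f, (shareGraph E' Set.univ).Reachable a z := by
      rcases hpq with ⟨h1, h2⟩ | ⟨rfl, rfl⟩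
      · have ha' : a ∈ E' e := by simp [he', h1.symm, ha]
        have hb' : b ∈ E' f := by simp [hf', h2.symm, hb]
        exact ⟨fun z hz => reachable_of_mem (Set.mem_univ e) ha' hz,
          fun z hz => hab'.trans (reachable_of_mem (Set.mem_univ f) hb' hz)⟩
      · have ha' : p ∈ E' f := by simp [hf']
        have hb' : q ∈ E' e := by simp [he']
        exact ⟨fun z hz => hab'.trans (reachable_of_mem (Set.mem_univ e) hb' hz),
          fun z hz => reachable_of_mem (Set.mem_univ f) ha' hz⟩
    have hef' : (∀ z ∈ E e, (shareGraph E' Set.univ).Reachable a z) ∧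
        ∀ z ∈ E f, (shareGraph E' Set.univ).Reachable a z := by
      constructor
      · intro z hz
        by_cases hzp : z = p
        · exact hall.2 z (by simp [hf', hzp])
        · exact hall.1 z (by simp [he', hzp, hz])
      · intro z hz
        by_cases hzq : z = q
        · exact hall.1 z (by simp [he', hzq])
        · exact hall.2 z (by simp [hf', hzq, hz])
    have := hE.connected.nonempty
    refine ⟨fun u w => Reachable.transfer ?_ (hE.connected u w)⟩
    intro i _ u hu w hw
    by_cases h1 : i = e
    · subst h1; exact (hef'.1 u hu).symm.trans (hef'.1 w hw)
    · by_cases h2 : i = f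
      · subst h2; exact (hef'.2 u hu).symm.trans (hef'.2 w hw)
      · rw [← hoff i h1 h2] at hu hw
        exact reachable_of_mem (Set.mem_univ i) hu hw
  have hprod_e : ∏ w ∈ E e, x w = x p * A := (Finset.mul_prod_erase _ _ hpe).symm
  have hprod_f : ∏ w ∈ E f, x w = x q * B := (Finset.mul_prod_erase _ _ hqf).symm
  have hprod_e' : ∏ w ∈ E' e, x w = x q * A := by rw [he', Finset.prod_insert hqe']
  have hprod_f' : ∏ w ∈ E' f, x w = x p * B := by rw [hf', Finset.prod_insert hpf']
  have hform : form E k x ≤ form E' k x := by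
    have h1 := sum_add_eq_of_eq_off hef hoff fun s => edgeForm k s x
    have h2 : ∑ w ∈ E' e, x w ^ k = x q ^ k + (∑ w ∈ E e, x w ^ k - x p ^ k) := by
      rw [he', Finset.sum_insert hqe', Finset.sum_erase_eq_sub hpe]
    have h3 : ∑ w ∈ E' f, x w ^ k = x p ^ k + (∑ w ∈ E f, x w ^ k - x q ^ k) := by
      rw [hf', Finset.sum_insert hpf', Finset.sum_erase_eq_sub hqf]
    simp only [edgeForm, hprod_e, hprod_f, hprod_e', hprod_f', h2, h3] at h1
    have h4 : 0 ≤ (k : ℝ) * ((x q - x p) * (A - B)) :=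
      mul_nonneg (Nat.cast_nonneg k) (mul_nonneg (sub_nonneg.2 hle) (sub_nonneg.2 hlt.le))
    simp only [form, edgeForm]
    linarith
  have hrow := hx.row_eq E' hcard hconn ⟨1, hdeg⟩ hform p
  have h1 := sum_add_eq_of_eq_off hef hoff fun s => if p ∈ s then x p ^ k + ∏ w ∈ s, x w else 0
  have hpe' : p ∉ E' e := by simp [he', hne]
  have hpf'' : p ∈ E' f := by simp [hf']
  simp only [row, Finset.sum_filter] at hrow
  simp only [hrow, hpe, hpf, hpe', hpf'', if_true, if_false, hprod_e, hprod_f'] at h1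
  have h2 : x p * A = x p * B := by linarith
  exact hlt.ne' (mul_left_cancel₀ (hx.pos p).ne' h2)

omit [Fintype V] in
/-- Comparison of two edges: `a` and `b` are the ends of the path between the edges `e` and `f`,
and `p ∈ e`, `q ∈ f` are either both or neither of the path's ends. -/
theorem IsExtremal.le_iff_prod_le (hx : IsExtremal E k x) (hE : IsArboreal E)
    (hk : ∀ i, (E i).card = k) (hk2 : 2 ≤ k) {e f : ι} (hef : e ≠ f) {a b p q : V}
    (ha : a ∈ E e) (hb : b ∈ E f) (hab : (shareGraph E {e, f}ᶜ).Reachable a b)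
    (hpe : p ∈ E e) (hqf : q ∈ E f)
    (hpq : (p ≠ a ∧ q ≠ b) ∨ (p = a ∧ q = b ∧ a ≠ b)) :
    x p ≤ x q ↔ ∏ w ∈ E e, x w ≤ ∏ w ∈ E f, x w := by
  have hpf : p ∉ E f := fun h => by
    have := hE.eq_of_mem_of_mem hef ha hb hab hpe h
    grind
  have hqe : q ∉ E e := fun h => by
    have := hE.eq_of_mem_of_mem hef ha hb hab h hqf
    grind
  have hpq' : (p ≠ a ∧ q ≠ b) ∨ (p = a ∧ q = b) := by tauto
  have hApos : 0 < ∏ w ∈ (E e).erase p, x w := Finset.prod_pos fun w _ => hx.pos w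
  have hBpos : 0 < ∏ w ∈ (E f).erase q, x w := Finset.prod_pos fun w _ => hx.pos w
  rw [← Finset.mul_prod_erase _ _ hpe, ← Finset.mul_prod_erase _ _ hqf]
  constructor
  · intro h
    exact mul_le_mul h (hx.prod_erase_le hE hk hk2 hef ha hb hab hpe hqf hpf hqe hpq' h)
      hApos.le (hx.pos q).le
  · intro h
    by_contra hlt
    push Not at hlt
    have := hx.prod_erase_le hE hk hk2 hef.symm hb ha (Set.pair_comm e f ▸ hab.symm) hqf hpe hqe hpf
      (by tauto) hlt.le
    exact absurd h (not_le.2 (mul_lt_mul hlt this hBpos (hx.pos p).le))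

omit [Fintype V] in
theorem IsArboreal.degree_pos (hE : IsArboreal E) (hne : ∀ i, (E i).Nonempty) {u v : V}
    (huv : v ≠ u) : 0 < degree E v := by
  obtain ⟨top, hR⟩ := hE.rooted hne u
  obtain ⟨i, hi, -⟩ := hR.exists_edge v huv
  exact Finset.card_pos.2 ⟨i, by simp [hi]⟩

omit [Fintype V] in
-- Otherwise `d_u - d_v` edges can be handed from `u` to `v`: the degrees are permuted by a
-- transposition, the form does not drop, and the row at `v` gains positive terms.
theorem IsExtremal.lt_of_degree_lt (hx : IsExtremal E k x) (hE : IsArboreal E)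
    (hk : ∀ i, (E i).card = k) (hk2 : 2 ≤ k) {u v : V} (huv : degree E v < degree E u) :
    x v < x u := by
  by_contra hle
  push Not at hle
  have hne : u ≠ v := fun h => by simp [h] at huv
  have hne0 : ∀ i, (E i).Nonempty := fun i => Finset.card_pos.1 (by rw [hk]; omega)
  obtain ⟨top, hR⟩ := hE.rooted hne0 v
  set h := (shareGraph E Set.univ).dist v
  have hvpos := hE.degree_pos hne0 hne.symm
  -- With the root at `v`, all edges at `u` but one have top `u` and hence miss `v`. As `d_v ≥ 1`,
  -- there are enough of them to move.
  have hdu : degree E u = (Finset.univ.filter fun i => top i = u).card + 1 := by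
    obtain ⟨j, hj1, hj2⟩ := hR.exists_edge u hne
    rw [degree, ← Finset.card_insert_of_notMem (a := j) (by simpa using hj2.symm)]
    congr 1
    ext i
    simp only [Finset.mem_filter, Finset.mem_univ, true_and, Finset.mem_insert]
    constructor
    · intro hi
      by_cases hiu : u = top i
      · exact Or.inr hiu.symm
      · exact Or.inl (hR.unique u i j hi hiu hj1 hj2)
    · rintro (rfl | rfl)
      · exact hj1
      · exact hR.top_mem i
  obtain ⟨S, hS, hScard⟩ := Finset.exists_subset_card_eq
    (s := Finset.univ.filter fun i => top i = u) (n := degree E u - degree E v) (by omega)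
  have hSu : ∀ i ∈ S, u ∈ E i := fun i hi => (Finset.mem_filter.1 (hS hi)).2 ▸ hR.top_mem i
  have hSv : ∀ i ∈ S, v ∉ E i := by
    intro i hi hv
    have htop := (Finset.mem_filter.1 (hS hi)).2
    have := hR.height_eq i v hv (by rw [htop]; exact hne.symm)
    rw [hR.height_root] at this
    omega
  obtain ⟨E', hE', hoff⟩ : ∃ E' : ι → Finset V, (∀ i ∈ S, E' i = insert v ((E i).erase u)) ∧
      ∀ i ∉ S, E' i = E i :=
    ⟨fun i => if i ∈ S then insert v ((E i).erase u) else E i, fun i hi => if_pos hi,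
      fun i hi => if_neg hi⟩
  have hv' : ∀ i ∈ S, v ∉ (E i).erase u := fun i hi h => hSv i hi (Finset.mem_of_mem_erase h)
  have hcard : ∀ i, (E' i).card = k := by
    intro i
    by_cases hi : i ∈ S
    · rw [hE' i hi, Finset.card_insert_of_notMem (hv' i hi), Finset.card_erase_of_mem (hSu i hi),
        hk]
      omega
    · rw [hoff i hi, hk]
  have hconn : (shareGraph E' Set.univ).Connected := by
    have huv' : (shareGraph E' Set.univ).Reachable u v := by
      refine Reachable.transfer ?_ (hR.descend u)
      intro i hi a ha b hb
      rw [← hoff i fun hiS => by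
        simp [(Finset.mem_filter.1 (hS hiS)).2] at hi] at ha hb
      exact reachable_of_mem (Set.mem_univ i) ha hb
    have hall : ∀ i ∈ S, ∀ z ∈ E i, (shareGraph E' Set.univ).Reachable v z := by
      intro i hi z hz
      by_cases hzu : z = u
      · exact hzu ▸ huv'.symm
      · exact reachable_of_mem (Set.mem_univ i) (by simp [hE' i hi]) (by simp [hE' i hi, hzu, hz])
    have := hE.connected.nonempty
    refine ⟨fun u w => Reachable.transfer ?_ (hE.connected u w)⟩
    intro i _ a ha b hb
    by_cases hi : i ∈ S
    · exact (hall i hi a ha).symm.trans (hall i hi b hb)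
    · rw [← hoff i hi] at ha hb
      exact reachable_of_mem (Set.mem_univ i) ha hb
  have hdeg_u : degree E' u + S.card = degree E u := by
    have : (Finset.univ.filter fun i => u ∈ E' i) = (Finset.univ.filter fun i => u ∈ E i) \ S := by
      ext i
      by_cases hi : i ∈ S
      · simp [hi, hE' i hi, hne]
      · simp [hi, hoff i hi]
    rw [degree, this, Finset.card_sdiff_add_card_eq_card, degree]
    exact fun i hi => by simp [hSu i hi]
  have hdeg_v : degree E' v = degree E v + S.card := by
    have : (Finset.univ.filter fun i => v ∈ E' i) =
        (Finset.univ.filter fun i => v ∈ E i).disjUnion S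
          (Finset.disjoint_left.2 fun i hi hiS => hSv i hiS (Finset.mem_filter.1 hi).2) := by
      ext i
      by_cases hi : i ∈ S
      · simp [hi, hE' i hi]
      · simp [hi, hoff i hi]
    rw [degree, this, Finset.card_disjUnion, degree]
  have hdeg : ∀ w, degree E' (Equiv.swap u v w) = degree E w := by
    intro w
    by_cases hwu : w = u
    · rw [hwu, Equiv.swap_apply_left]; omega
    · by_cases hwv : w = v
      · rw [hwv, Equiv.swap_apply_right]; omega
      · rw [Equiv.swap_apply_of_ne_of_ne hwu hwv, degree, degree]
        congr 1
        ext i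
        by_cases hi : i ∈ S
        · simp [hE' i hi, hwu, hwv]
        · simp [hoff i hi]
  have hform : form E k x ≤ form E' k x := by
    refine Finset.sum_le_sum fun i _ => ?_
    by_cases hi : i ∈ S
    · rw [edgeForm, edgeForm, hE' i hi, Finset.sum_insert (hv' i hi), Finset.prod_insert (hv' i hi),
        ← Finset.add_sum_erase _ _ (hSu i hi), ← Finset.mul_prod_erase _ _ (hSu i hi)]
      have hP : 0 ≤ ∏ w ∈ (E i).erase u, x w := Finset.prod_nonneg fun w _ => (hx.pos w).le
      have hu0 := (hx.pos u).le
      gcongr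
    · rw [hoff i hi]
  have hrow := hx.row_eq E' hcard hconn ⟨_, hdeg⟩ hform v
  refine hrow.not_gt ?_
  simp only [row, Finset.sum_filter]
  have hSne : S.Nonempty := Finset.card_pos.1 (by omega)
  obtain ⟨i, hi⟩ := hSne
  have hterm : ∀ j, 0 < x v ^ k + ∏ w ∈ E' j, x w := fun j =>
    add_pos (pow_pos (hx.pos v) k) (Finset.prod_pos fun w _ => hx.pos w)
  refine Finset.sum_lt_sum (fun j _ => ?_) ⟨i, Finset.mem_univ i, ?_⟩
  · by_cases hj : j ∈ S
    · rw [if_neg (hSv j hj)]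
      split_ifs
      · exact (hterm j).le
      · exact le_rfl
    · rw [hoff j hj]
  · rw [if_neg (hSv i hi), if_pos (by simp [hE' i hi])]
    exact hterm i

end

/-! ### Construction of the BFS-ordering. -/

section

variable {V ι : Type*} [Fintype ι] {E : ι → Finset V} {k : ℕ} {x : V → ℝ}

theorem exists_mem_of_reachable {ι : Type*} {E : ι → Finset V} {S : Set ι} {a b : V} (hab : a ≠ b)
    (h : (shareGraph E S).Reachable a b) : ∃ i ∈ S, a ∈ E i := by
  obtain ⟨p⟩ := h
  cases p with
  | nil => exact absurd rfl hab
  | cons hadj _ =>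
    obtain ⟨_, i, hi, ha, -⟩ := hadj
    exact ⟨i, hi, ha⟩

/-- Induction on the height of `u`: the comparison of `v` with `u` is transferred to one involving
the top of the parent edge `e` of `u`, where the induction hypothesis applies. The cases depend on
which vertex of `e` ends the path between the edges. -/
theorem IsExtremal.le_of_height_lt (hx : IsExtremal E k x) (hE : IsArboreal E)
    (hdeg : ∀ u v, degree E v < degree E u → x v < x u)
    (hk : ∀ i, (E i).card = k) (hk2 : 2 ≤ k) {v₀ : V} {h : V → ℕ} {top : ι → V}
    (hR : Rooted E v₀ h top) (hv₀ : ∀ v, x v ≤ x v₀) {u v : V} (huv : h u < h v) : x v ≤ x u := by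
  induction hn : h u using Nat.strong_induction_on generalizing u v with
  | _ n ih =>
    by_cases hu0 : u = v₀
    · rw [hu0]; exact hv₀ v
    have hvne : v ≠ v₀ := fun hv => by
      rw [hv, hR.height_root] at huv
      omega
    obtain ⟨e, hue, hut⟩ := hR.exists_edge u hu0
    obtain ⟨f, hvf, hvt⟩ := hR.exists_edge v hvne
    have hhu := hR.height_eq e u hue hut
    have hhv := hR.height_eq f v hvf hvt
    have hef : e ≠ f := by rintro rfl; omega
    have hle : ∀ w, h (top e) < h w → x w ≤ x (top e) := fun w hw => ih _ (by omega) hw rfl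
    rcases hR.descend_avoiding e (top f) with hr | ⟨y, hy, hyt, hr⟩
    · have hab : (shareGraph E {f, e}ᶜ).Reachable (top f) (top e) := by
        refine (Reachable.mono ?_ hr).trans (Reachable.mono ?_ (hR.descend (top e))).symm
        · rintro j ⟨hj1, hj2⟩
          simp only [Set.mem_compl_iff, Set.mem_insert_iff, Set.mem_singleton_iff, not_or]
          exact ⟨fun h => by simp [h] at hj1, hj2⟩
        · intro j hj
          simp only [Set.mem_ofPred_eq] at hj
          simp only [Set.mem_compl_iff, Set.mem_insert_iff, Set.mem_singleton_iff, not_or]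
          constructor <;> rintro rfl <;> omega
      -- The path joins the two tops, so `v` and `u` compare as their parents do.
      rw [hx.le_iff_prod_le hE hk hk2 hef.symm (hR.top_mem f) (hR.top_mem e) hab hvf hue
        (Or.inl ⟨hvt, hut⟩),
        ← hx.le_iff_prod_le hE hk hk2 hef.symm (hR.top_mem f) (hR.top_mem e) hab (hR.top_mem f)
        (hR.top_mem e) (Or.inr ⟨rfl, rfl, fun h => by rw [h] at hhv; omega⟩)]
      exact hle _ (by omega)
    -- The path reaches `e` at a non-top vertex `y`. If `y = u`, then `u` is an end and `v` is not,
    -- so this pair cannot be exchanged; the degree comparison yields another edge `g` with top `v`,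
    -- the path from `g` to `e` has ends `v` and `u`, and the transfer goes to `w` and `top e`. If
    -- `y ≠ u`, it goes to `v` and `top e`.
    · by_cases hyu : y = u
      · subst hyu
        by_contra hlt
        push Not at hlt
        have hdle : degree E y ≤ degree E v := by
          by_contra hd
          exact lt_asymm hlt (hdeg _ _ (not_le.1 hd))
        have hyv : (shareGraph E {e}ᶜ).Reachable y v := by
          refine (Reachable.mono ?_ hr).symm.trans
            (reachable_of_mem (i := f) hef.symm (hR.top_mem f) hvf)
          exact fun j hj => hj.2
        obtain ⟨j, hje, hyj⟩ := exists_mem_of_reachable (fun h => by rw [h] at huv; omega) hyv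
        have hd2 : 2 ≤ degree E y := by
          rw [← Finset.card_pair (Ne.symm hje)]
          refine Finset.card_le_card fun l hl => ?_
          rcases Finset.mem_insert.1 hl with rfl | hl
          · simp [hue]
          · rw [Finset.mem_singleton.1 hl]; simp [hyj]
        obtain ⟨g, hg, hgf⟩ := Finset.exists_mem_ne (hd2.trans hdle) f
        have hvg : v ∈ E g := by simpa using hg
        have hgt : v = top g := by
          by_contra hne
          exact hgf (hR.unique v g f hvg hne hvf hvt)
        obtain ⟨w, hw, hwt⟩ := Finset.exists_mem_ne ((hk g).symm ▸ hk2) (top g)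
        have hhw := hR.height_eq g w hw hwt
        rw [← hgt] at hhw
        have hge : g ≠ e := by rintro rfl; rw [← hgt] at hhu; omega
        have hab : (shareGraph E {g, e}ᶜ).Reachable v y := by
          refine (reachable_of_mem (i := f) ?_ hvf (hR.top_mem f)).trans (Reachable.mono ?_ hr)
          · simp [hgf.symm, hef.symm]
          · rintro j ⟨hj1, hj2⟩
            simp only [Set.mem_compl_iff, Set.mem_insert_iff, Set.mem_singleton_iff, not_or]
            refine ⟨?_, hj2⟩
            rintro rfl
            rw [← hgt] at hj1
            omega
        refine not_le.2 hlt ?_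
        rw [hx.le_iff_prod_le hE hk hk2 hge hvg hue hab hvg hue
          (Or.inr ⟨rfl, rfl, fun h => by rw [h] at huv; omega⟩),
          ← hx.le_iff_prod_le hE hk hk2 hge hvg hue hab hw (hR.top_mem e)
          (Or.inl ⟨fun h => hwt (h.trans hgt), hyt.symm⟩)]
        exact hle _ (by omega)
      · have hab : (shareGraph E {f, e}ᶜ).Reachable (top f) y := by
          refine Reachable.mono ?_ hr
          rintro j ⟨hj1, hj2⟩
          simp only [Set.mem_compl_iff, Set.mem_insert_iff, Set.mem_singleton_iff, not_or]
          exact ⟨fun h => by simp [h] at hj1, hj2⟩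
        rw [hx.le_iff_prod_le hE hk hk2 hef.symm (hR.top_mem f) hy hab hvf hue
          (Or.inl ⟨hvt, Ne.symm hyu⟩),
          ← hx.le_iff_prod_le hE hk hk2 hef.symm (hR.top_mem f) hy hab hvf (hR.top_mem e)
          (Or.inl ⟨hvt, Ne.symm hyt⟩)]
        exact hle _ (by omega)

/-- Sorting by decreasing `g`, ties broken arbitrarily: distinct ranks keep edges with equal
products apart. -/
theorem exists_rank {α : Type*} [Fintype α] (g : α → ℝ) : ∃ ρ : α → ℕ, Function.Injective ρ ∧
    (∀ a, ρ a < Fintype.card α) ∧ ∀ a b, ρ a ≤ ρ b → g b ≤ g a := by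
  let e := Fintype.equivFin α
  let σ := Tuple.sort fun j => -g (e.symm j)
  refine ⟨fun a => (σ.symm (e a) : Fin _), ?_, fun a => Fin.is_lt _, fun a b hab => ?_⟩
  · exact Fin.val_injective.comp (σ.symm.injective.comp e.injective)
  · have := Tuple.monotone_sort (fun j => -g (e.symm j)) (show σ.symm (e a) ≤ σ.symm (e b) from hab)
    change -g (e.symm (σ (σ.symm (e a)))) ≤ -g (e.symm (σ (σ.symm (e b)))) at this
    simpa using this

omit [Fintype ι] in
theorem Rooted.ne_root {v₀ : V} {h : V → ℕ} {top : ι → V} (hR : Rooted E v₀ h top) {i : ι} {v : V}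
    (hv : v ∈ E i) (hvt : v ≠ top i) : v ≠ v₀ := by
  rintro rfl
  have := hR.height_eq i _ hv hvt
  rw [hR.height_root] at this
  omega

omit [Fintype ι] in
theorem Rooted.eq_root {v₀ : V} {h : V → ℕ} {top : ι → V} (hR : Rooted E v₀ h top) {v : V}
    (hv : h v = 0) : v = v₀ := by
  by_contra hne
  obtain ⟨i, h1, h2⟩ := hR.exists_edge v hne
  have := hR.height_eq i v h1 h2
  omega

omit [Fintype ι] in
-- For ranks below `M` these are base-`M` digits: within a level, codes compare first by parent,
-- then by edge rank, then by vertex rank. The code is built by recursion on height.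
theorem Rooted.exists_code {v₀ : V} {h : V → ℕ} {top : ι → V} (hR : Rooted E v₀ h top)
    (M : ℕ) (ρE : ι → ℕ) (ρV : V → ℕ) : ∃ c : V → ℕ, ∀ i, ∀ v ∈ E i, v ≠ top i →
      c v = (c (top i) * M + ρE i) * M + ρV v := by
  let C : ℕ → V → ℕ := fun n => Nat.rec (fun _ => 0) (fun _ C v =>
    if hv : v ≠ v₀ then
      (C (top (hR.exists_edge v hv).choose) * M + ρE (hR.exists_edge v hv).choose) * M + ρV v
    else 0) n
  refine ⟨fun v => C (h v) v, fun i v hv hvt => ?_⟩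
  have hv₀ := hR.ne_root hv hvt
  have hi : (hR.exists_edge v hv₀).choose = i :=
    hR.unique v _ _ (hR.exists_edge v hv₀).choose_spec.1 (hR.exists_edge v hv₀).choose_spec.2 hv hvt
  change C (h v) v = (C (h (top i)) (top i) * M + ρE i) * M + ρV v
  rw [hR.height_eq i v hv hvt]
  change (if hv : v ≠ v₀ then (C (h (top i)) (top (hR.exists_edge v hv).choose) * M +
    ρE (hR.exists_edge v hv).choose) * M + ρV v else 0) = _
  rw [dif_pos hv₀, hi]

theorem IsExtremal.exists_isBFSOrdering [Fintype V] (hx : IsExtremal E k x) (hE : IsArboreal E)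
    (hinj : Function.Injective E) (hk : ∀ i, (E i).card = k) (hk2 : 2 ≤ k) {v₀ : V}
    (hv₀ : ∀ v, x v ≤ x v₀) : ∃ r, (toHypergraph E).IsBFSOrdering k v₀ r := by
  have hdeg : ∀ u v, degree E v < degree E u → x v < x u :=
    fun u v => hx.lt_of_degree_lt hE hk hk2
  obtain ⟨top, hR⟩ := hE.rooted (fun i => Finset.card_pos.1 (by rw [hk]; omega)) v₀
  have hdist : ∀ v, (toHypergraph E).pathDist v₀ v = (shareGraph E Set.univ).dist v₀ v :=
    fun v => pathDist_eq hinj (hE.connected v₀ v)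
  set h := (shareGraph E Set.univ).dist v₀
  obtain ⟨ρE, hρE, hEM, hEmono⟩ := exists_rank fun i => ∏ w ∈ E i, x w
  obtain ⟨ρV, hρV, hVM, hVmono⟩ := exists_rank x
  set M := Fintype.card ι + Fintype.card V with hM
  obtain ⟨c, hc⟩ := hR.exists_code M ρE ρV
  have hmod : ∀ i, ∀ v ∈ E i, v ≠ top i → c v % M = ρV v := by
    intro i v hv hvt
    have := hVM v
    rw [hc i v hv hvt, Nat.mul_comm _ M, Nat.mul_add_mod, Nat.mod_eq_of_lt (by omega)]
  have hdiv : ∀ i, ∀ v ∈ E i, v ≠ top i → c v / M = c (top i) * M + ρE i := by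
    intro i v hv hvt
    have := hVM v
    rw [hc i v hv hvt, Nat.mul_comm _ M, Nat.mul_add_div (by omega),
      Nat.div_eq_of_lt (by omega), add_zero]
  have hEdiv : ∀ i, (c (top i) * M + ρE i) / M = c (top i) := by
    intro i
    have := hEM i
    rw [Nat.mul_comm _ M, Nat.mul_add_div (by omega), Nat.div_eq_of_lt (by omega), add_zero]
  have hEmod : ∀ i, (c (top i) * M + ρE i) % M = ρE i := by
    intro i
    have := hEM i
    rw [Nat.mul_comm _ M, Nat.mul_add_mod, Nat.mod_eq_of_lt (by omega)]
  have hcinj : ∀ u v, h u = h v → c u = c v → u = v := by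
    intro u v huv hcuv
    by_cases hu : u = v₀
    · rw [hu, hR.height_root] at huv
      rw [hu, hR.eq_root huv.symm]
    · have hv : v ≠ v₀ := fun hv => by
        rw [hv, hR.height_root] at huv
        exact hu (hR.eq_root huv)
      obtain ⟨e, hue, hut⟩ := hR.exists_edge u hu
      obtain ⟨f, hvf, hvt⟩ := hR.exists_edge v hv
      apply hρV
      rw [← hmod e u hue hut, ← hmod f v hvf hvt, hcuv]
  have hpar : ∀ e f u v, u ∈ E e → u ≠ top e → v ∈ E f → v ≠ top f → c u ≤ c v →
      c (top e) ≤ c (top f) := by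
    intro e f u v hue hut hvf hvt huv
    have h1 : c u / M ≤ c v / M := Nat.div_le_div_right huv
    rw [hdiv e u hue hut, hdiv f v hvf hvt] at h1
    have h2 := Nat.div_le_div_right (c := M) h1
    rwa [hEdiv, hEdiv] at h2
  -- Vertices of one level in different parent edges compare as the edge products do. These compare
  -- as the parents if the parents differ, and by edge rank if they coincide.
  have hsame : ∀ n u v, h u = n → h v = n → c u ≤ c v → x v ≤ x u := by
    intro n
    induction n with
    | zero =>
      intro u v hu hv _
      rw [hR.eq_root hu, hR.eq_root hv]
    | succ n ih =>
      intro u v hu hv huv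
      have hne : ∀ w, h w = n + 1 → w ≠ v₀ := fun w hw hw0 => by
        rw [hw0, hR.height_root] at hw
        omega
      obtain ⟨e, hue, hut⟩ := hR.exists_edge u (hne u hu)
      obtain ⟨f, hvf, hvt⟩ := hR.exists_edge v (hne v hv)
      have hhu := hR.height_eq e u hue hut
      have hhv := hR.height_eq f v hvf hvt
      have h1 : c u / M ≤ c v / M := Nat.div_le_div_right huv
      rw [hdiv e u hue hut, hdiv f v hvf hvt] at h1
      by_cases hef : e = f
      · subst hef
        apply hVmono
        rw [hc e u hue hut, hc e v hvf hvt] at huv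
        omega
      have hab : (shareGraph E {f, e}ᶜ).Reachable (top f) (top e) := by
        refine (Reachable.mono ?_ (hR.descend (top f))).trans
          (Reachable.mono ?_ (hR.descend (top e))).symm <;>
        · intro j hj
          simp only [Set.mem_ofPred_eq] at hj
          simp only [Set.mem_compl_iff, Set.mem_insert_iff, Set.mem_singleton_iff, not_or]
          constructor <;> rintro rfl <;> omega
      rw [hx.le_iff_prod_le hE hk hk2 (Ne.symm hef) (hR.top_mem f) (hR.top_mem e) hab hvf hue
        (Or.inl ⟨hvt, hut⟩)]
      by_cases htop : top f = top e
      · apply hEmono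
        rw [htop] at h1
        omega
      · rw [← hx.le_iff_prod_le hE hk hk2 (Ne.symm hef) (hR.top_mem f) (hR.top_mem e) hab
          (hR.top_mem f) (hR.top_mem e) (Or.inr ⟨rfl, rfl, htop⟩)]
        exact ih _ _ (by omega) (by omega) (hpar e f u v hue hut hvf hvt huv)
  let φ : V → ℕ ×ₗ ℕ := fun v => toLex (h v, c v)
  have hφ : ∀ u v, φ u < φ v ↔ h u < h v ∨ h u = h v ∧ c u < c v := fun u v =>
    Prod.Lex.toLex_lt_toLex
  have hφinj : Function.Injective φ := by
    intro u v huv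
    have := Prod.ext_iff.1 (toLex.injective huv)
    exact hcinj u v this.1 this.2
  have hmono : ∀ u v, φ u < φ v → x v ≤ x u := by
    intro u v huv
    rcases (hφ u v).1 huv with h1 | ⟨h1, h2⟩
    · exact hx.le_of_height_lt hE hdeg hk hk2 hR hv₀ h1
    · exact hsame _ u v rfl h1.symm h2.le
  have hhle : ∀ u v, φ u < φ v → h u ≤ h v := by
    intro u v huv
    rcases (hφ u v).1 huv with h1 | ⟨h1, -⟩
    · exact h1.le
    · exact h1.le
  refine ⟨fun u v => φ u < φ v, ?_, ?_, ?_, ?_, ?_⟩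
  · exact (⟨⟨φ, hφinj⟩, Iff.rfl⟩ : (fun u v => φ u < φ v) ↪r
      ((· < ·) : ℕ ×ₗ ℕ → ℕ ×ₗ ℕ → Prop)).isWellOrder
  · intro u v huv
    rw [hdist, hdist]
    exact hhle u v huv
  · intro u v huv
    rw [vertexDegree_eq hinj, vertexDegree_eq hinj]
    by_contra hlt
    exact absurd (hmono u v huv) (not_le.2 (hdeg v u (not_le.1 hlt)))
  · rintro u v u₁ v₁ _ ⟨e, rfl⟩ _ ⟨f, rfl⟩ hu hu₁ hv hv₁ huv hhu hhv
    rw [hdist, hdist] at hhu hhv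
    have htop : ∀ i, ∀ w ∈ E i, ∀ w₁ ∈ E i, h w = h w₁ + 1 → w ≠ top i ∧ w₁ = top i := by
      intro i w hw w₁ hw₁ hww
      have h1 : w ≠ top i := by
        rintro rfl
        have := hR.height_eq i w₁ hw₁ (fun h => by rw [h] at hww; omega)
        omega
      refine ⟨h1, ?_⟩
      by_contra h2
      have h3 := hR.height_eq i w hw h1
      have h4 := hR.height_eq i w₁ hw₁ h2
      omega
    obtain ⟨hut, rfl⟩ := htop e u hu u₁ hu₁ hhu
    obtain ⟨hvt, rfl⟩ := htop f v hv v₁ hv₁ hhv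
    rw [hφ]
    rcases (hφ u v).1 huv with h1 | ⟨h1, h2⟩
    · exact Or.inl (Or.inl (by omega))
    · have h3 := hpar e f u v hu hut hv hvt h2.le
      rcases h3.lt_or_eq with h4 | h4
      · exact Or.inl (Or.inr ⟨by omega, h4⟩)
      · exact Or.inr (hcinj _ _ (by omega) h4)
  · rintro _ ⟨i, rfl⟩ w hw hmonow a ha ha1 v hv ⟨hwv, hvw⟩
    have hmem : ∀ b, w b ∈ E i := fun b => by
      have : w b ∈ Set.range w := ⟨b, rfl⟩
      rw [hw] at this
      exact this
    -- The top is strictly lowest, so it is `w 0`. The other vertices of the edge share the quotient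
    -- `c / M`; anything between two of them has the same height and quotient, hence the same parent
    -- edge.
    have hnt : ∀ b : Fin k, 0 < (b : ℕ) → w b ≠ top i := by
      intro b hb hbt
      have h1 := hmonow ⟨0, by omega⟩ b hb
      have h2 := hR.height_eq i (w ⟨0, by omega⟩) (hmem _) (fun h3 => by
        rw [← hbt] at h3
        simp [h3] at h1)
      have h3 := hhle _ _ h1
      rw [hbt] at h3
      omega
    have h1 := hnt ⟨a, Nat.lt_of_succ_lt ha⟩ ha1
    have h2 := hnt ⟨a + 1, ha⟩ (Nat.succ_pos a)
    have h3 := hmem ⟨a, Nat.lt_of_succ_lt ha⟩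
    have h4 := hmem ⟨a + 1, ha⟩
    generalize w ⟨a, Nat.lt_of_succ_lt ha⟩ = w₁ at *
    generalize w ⟨a + 1, ha⟩ = w₂ at *
    have h5 := hR.height_eq i w₁ h3 h1
    have h6 := hR.height_eq i w₂ h4 h2
    have h7 := (hφ _ _).1 hwv
    have h8 := (hφ _ _).1 hvw
    have hv0 : v ≠ v₀ := fun h => by
      have := hR.height_root
      rw [← h] at this
      omega
    obtain ⟨j, hj, hjt⟩ := hR.exists_edge v hv0
    have h9 : c w₁ / M ≤ c v / M := Nat.div_le_div_right (by omega)
    have h10 : c v / M ≤ c w₂ / M := Nat.div_le_div_right (by omega)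
    rw [hdiv i w₁ h3 h1, hdiv j v hj hjt] at h9
    rw [hdiv i w₂ h4 h2, hdiv j v hj hjt] at h10
    have h11 := congrArg (· % M) (le_antisymm h9 h10)
    simp only [hEmod] at h11
    exact hv (hρE h11 ▸ hj)

end

end EdgeFamily

/-! ### The theorem. -/

open EdgeFamily in
theorem theorem4p6 {V : Type*} [Fintype V] (k : ℕ) (hk : 2 ≤ k) (n : ℕ) (π : Fin n → ℕ)
    (G : Hypergraph V) (hG : G ∈ Hypergraph.supertreesWithDegrees V k π)
    (hmax : ∀ G' ∈ Hypergraph.supertreesWithDegrees V k π,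
      G'.signlessSpectralRadius k ≤ G.signlessSpectralRadius k) :
    G.IsBFSSupertree k := by
  obtain ⟨hT, σ, hσ⟩ := hG
  obtain ⟨E, hinj, hGE⟩ := exists_eq_toHypergraph hT.vertexSet_eq
  have : Fintype {s : Finset V // (s : Set V) ∈ G.edgeSet} := Fintype.ofFinite _
  generalize {s : Finset V // (s : Set V) ∈ G.edgeSet} = ι at *
  subst hGE
  have hcard : ∀ i, (E i).card = k := fun i => by
    have := hT.uniform _ ⟨i, rfl⟩
    rw [Set.encard_coe_eq_coe_finsetCard] at this
    exact_mod_cast this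
  have hE := isArboreal_of_isUniformSupertree hinj hT
  obtain ⟨q, hq⟩ : ∃ q, q = (toHypergraph E).signlessSpectralRadius k := ⟨_, rfl⟩
  obtain ⟨hle, x, hpos, hxq⟩ := signlessSpectralRadius_spec hE.connected hinj hcard hk
  rw [← hq] at hle hxq
  have := hE.connected.nonempty
  have hVcard : Fintype.card V = Fintype.card ι * (k - 1) + 1 := by
    obtain ⟨top, hR⟩ := hE.rooted (fun i => Finset.card_pos.1 (by rw [hcard]; omega))
      (Classical.arbitrary V)
    exact hR.card_eq hcard
  -- A form of `E'` at `x` of at least `q * ∑ x ^ k`, with the radius of `E'` at most `q`, forces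
  -- equality. So `x` attains the bound `q` for both families, and both rows equal `q * x v ^ k`.
  have hx : IsExtremal E k x := by
    refine ⟨hpos, fun E' hcard' hconn' ⟨τ, hτ⟩ hform v => ?_⟩
    obtain ⟨hinj', hT'⟩ := isUniformSupertree_of_card hk hcard' hconn' hVcard
    have hq' := hmax _ ⟨hT', σ.trans τ, fun i => by
      rw [vertexDegree_eq hinj', Equiv.trans_apply, hτ, ← vertexDegree_eq hinj, hσ]⟩
    rw [← hq] at hq'
    have hle' : ∀ y : V → ℝ, (∀ v, 0 ≤ y v) → form E' k y ≤ q * ∑ v, y v ^ k := fun y hy =>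
      ((signlessSpectralRadius_spec hconn' hinj' hcard' hk).1 y hy).trans
        (mul_le_mul_of_nonneg_right hq' (Finset.sum_nonneg fun v _ => pow_nonneg (hy v) k))
    rw [row_eq_of_maximizer (by omega) hpos hxq hle v,
      row_eq_of_maximizer (by omega) hpos
        (le_antisymm (hle' x fun v => (hpos v).le) (hxq ▸ hform)) hle' v]
  obtain ⟨v₀, hv₀⟩ := Finite.exists_max x
  exact ⟨hT, v₀, hx.exists_isBFSOrdering hE hinj hcard hk hv₀⟩
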